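/- A Boolean function $f:\{0,1\}^n\to\{0,1\}$ is a $k$-junta if it depends on at most $k$ of its variables. It is $\varepsilon$-close to a $k$-junta if it disagrees with some $k$-junta on at most $\varepsilon 2^n$ inputs, and $\varepsilon$-far from $k$-juntas if it disagrees with every $k$-junta on at least $\varepsilon 2^n$ inputs. A $(k,\varepsilon_1,\varepsilon_2)$-tolerant junta tester is a randomized algorithm which, given adaptive query access to an unknown $f:\{0,1\}^n\to\{0,1\}$ (for any given $n$), accepts with probability at least $2/3$ if $f$ is $\varepsilon_1$-close to a $k$-junta, and rejects with probability at least $2/3$ if $f$ is $\varepsilon_2$-far from $k$-juntas. The number of queries is counted in the worst case over the function and the random choices. Theorem. For every constant $C>0$ there is a constant $c>0$ such that the following holds. Let $k$ be a positive integer and let $0.01\le\varepsilon_1<\varepsilon_2\le 0.49$ be such that $\varepsilon_2-\varepsilon_1\ge 2^{-Ck^{0.99}}$. Then any $(k,\varepsilon_1,\varepsilon_2)$-tolerant junta tester requires at least $k^{-c\log_2(\varepsilon_2-\varepsilon_1)}$ queries; more precisely, there is a number $n$ of variables, depending only on $k,\varepsilon_1,\varepsilon_2$ and the constants, such that every $(k,\varepsilon_1,\varepsilon_2)$-tolerant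 junta tester for functions $f:\{0,1\}^n\to\{0,1\}$ makes at least that many queries. -/

import Mathlib

namespace JuntaTesting

/-- Boolean functions `{0,1}ⁿ → {0,1}`. -/
abbrev BoolFun (n : ℕ) : Type := (Fin n → Bool) → Bool

/-- `f` is a `k`-junta: its value is determined by some set of at most `k` of its variables. -/
def IsJunta {n : ℕ} (k : ℕ) (f : BoolFun n) : Prop :=
  ∃ S : Finset (Fin n), S.card ≤ k ∧ DependsOn f (S : Set (Fin n))

/-- `f` is `ε`-close to a `k`-junta: for some `k`-junta `g`, the functions `f` and `g` disagree
on no more than `ε 2ⁿ` inputs. -/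
def IsCloseToJunta {n : ℕ} (k : ℕ) (ε : ℝ) (f : BoolFun n) : Prop :=
  ∃ g : BoolFun n, IsJunta k g ∧ (hammingDist f g : ℝ) ≤ ε * 2 ^ n

/-- `f` is `ε`-far from `k`-juntas: `f` disagrees with every `k`-junta on at least `ε 2ⁿ`
inputs. -/
def IsFarFromJuntas {n : ℕ} (k : ℕ) (ε : ℝ) (f : BoolFun n) : Prop :=
  ∀ g : BoolFun n, IsJunta k g → ε * 2 ^ n ≤ (hammingDist f g : ℝ)

/-- A deterministic adaptive query algorithm with access to an unknown `f : {0,1}ⁿ → {0,1}`: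
it either halts, accepting (`true`) or rejecting (`false`), or it queries `f` at a point `x` and
continues in a way that may depend on the answer `f x` (and hence on all earlier answers). -/
inductive QueryTree (n : ℕ) : Type
  | halt (accept : Bool) : QueryTree n
  | query (x : Fin n → Bool) (next : Bool → QueryTree n) : QueryTree n

/-- The verdict of the algorithm on the function `f`. -/
def QueryTree.verdict {n : ℕ} : QueryTree n → BoolFun n → Bool
  | .halt b, _ => b
  | .query x next, f => (next (f x)).verdict f

/-- The number of queries that the algorithm makes on the function `f`. -/
def QueryTree.queryCount {n : ℕ} : QueryTree n → BoolFun n → ℕ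
  | .halt _, _ => 0
  | .query x next, f => (next (f x)).queryCount f + 1

/-- A randomized adaptive query algorithm: a probability distribution on deterministic ones.
There are only countably many of the latter, so `PMF` covers every probability distribution. -/
abbrev RandomizedAlg (n : ℕ) : Type := PMF (QueryTree n)

/-- The distribution of the verdict of `A` on `f`: `A.verdictOn f true` is the probability that
`A` accepts `f`, and `A.verdictOn f false` the probability that it rejects `f`. -/
noncomputable def RandomizedAlg.verdictOn {n : ℕ} (A : RandomizedAlg n) (f : BoolFun n) :
    PMF Bool :=
  A.map fun T => T.verdict f

/-- `A` makes at most `q` queries, whatever the function and the outcome of its coins. -/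
def RandomizedAlg.MakesAtMost {n : ℕ} (A : RandomizedAlg n) (q : ℕ) : Prop :=
  ∀ T ∈ A.support, ∀ f : BoolFun n, T.queryCount f ≤ q

/-- `A` is a `(k, ε₁, ε₂)`-tolerant junta tester for functions of `n` variables: it accepts every
function that is `ε₁`-close to a `k`-junta, and rejects every function that is `ε₂`-far from
`k`-juntas, each with probability at least `2/3`. -/
structure IsTolerantJuntaTester {n : ℕ} (k : ℕ) (ε₁ ε₂ : ℝ) (A : RandomizedAlg n) : Prop where
  accepts : ∀ f : BoolFun n, IsCloseToJunta k ε₁ f →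
    2 / 3 ≤ RandomizedAlg.verdictOn A f true
  rejects : ∀ f : BoolFun n, IsFarFromJuntas k ε₂ f →
    2 / 3 ≤ RandomizedAlg.verdictOn A f false

end JuntaTesting

/-!
A tester with few queries is defeated by two distributions of functions that it cannot tell apart.

The hard functions. Random signs on a subcube with `N` points have a bias of order `N ^ (-1/2)`,
so a random Boolean function `F` of `n = k + 16 w` variables, of which a `k`-junta ignores at least
`16 w`, has distance about `(1 - σ) / 2` from all `k`-juntas, with `σ = 2 ^ (-8 w)`. Now hide `16`
disjoint blocks of `w` variables each, and let `collapse` be a map that picks a representative of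
each point modulo the negation of whole blocks. The function `F ∘ collapse` takes only
`2 ^ (16 (w - 1))` independent values on each of the subcubes spanned by the hidden variables, so
it is closer to the juntas on the other `k` variables: its distance from them is at most about
`(1 - 144 σ) / 2`, and it is a `k`-junta if `w = 1`. Both functions are made to vanish outside of a
region that is given by variables known not to be hidden. The density of the region scales both
distances, which places them around a given pair `ε₁ < ε₂` with `ε₂ - ε₁ ≤ σ`. The bounds on the
mean bias come from second and fourth moments (`sum_abs_add_signs_le`, `le_sum_abs_signs`), and the
bias is concentrated by the Efron–Stein inequality (`sum_sq_sub_mean_le`), well enough for a union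
bound over all sets of `k` variables (`card_not_isFarFromJuntas_le`).

Indistinguishability. As long as no two queried points have the same representative,
`F ∘ collapse` answers like `F` (`card_verdict_le`). Two distinct points with the same
representative differ exactly in some hidden blocks, so they reveal one of them entirely
(`exists_block_of_collapse_eq`). Each of the `w` elements of a block is chosen among `a` variables,
so a given pair of points does so with probability at most `16 / a ^ w`, and a tester needs
`a ^ w ≤ 64 q ^ 2` (`pow_le_of_isTolerantJuntaTester`).

Parameters. With `w` about `log₂ (1 / (ε₂ - ε₁)) / 8 = O(k ^ 0.99)` and `a = ⌊k / (32 w)⌋`, which is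
at least a power of `k`, this is the bound for large `k`. For the finitely many other `k` the
constant `c` is so small that the bound is at most `2`, and one query never suffices, because
all pairs of a function and its negation look alike to an algorithm that makes a single one.
-/

namespace JuntaTesting

/-! ### Moments of random signs -/

/-- The sign `(-1)^b` of a bit. -/
def sgn (b : Bool) : ℝ := if b then -1 else 1

lemma sgn_not (b : Bool) : sgn (!b) = -sgn b := by cases b <;> simp [sgn]

lemma sgn_mul_self (b : Bool) : sgn b * sgn b = 1 := by cases b <;> simp [sgn]

lemma abs_sgn (b : Bool) : |sgn b| = 1 := by cases b <;> simp [sgn]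

section Moments

variable {X : Type*} [DecidableEq X]

/-- Negating the value of a Boolean function at the point `x`. -/
def flipAt (x : X) : (X → Bool) ≃ (X → Bool) :=
  Function.Involutive.toPerm (fun F => Function.update F x (!F x)) (by
    intro F
    ext y
    by_cases h : y = x
    · subst h; simp
    · simp [h])

lemma flipAt_self (x : X) (F : X → Bool) : flipAt x F x = !F x :=
  Function.update_self ..

lemma flipAt_ne {x y : X} (h : y ≠ x) (F : X → Bool) : flipAt x F y = F y :=
  Function.update_of_ne h ..

variable [Fintype X]

/-- A sign is uncorrelated with every function of the signs at other points. -/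
lemma sum_sgn_mul_eq_zero {x : X} {B : Finset X} (hx : x ∉ B) (φ : ℝ → ℝ) :
    ∑ F : X → Bool, sgn (F x) * φ (∑ y ∈ B, sgn (F y)) = 0 := by
  have h := Equiv.sum_comp (flipAt x) (fun F : X → Bool => sgn (F x) * φ (∑ y ∈ B, sgn (F y)))
  have h2 : ∀ F : X → Bool, ∑ y ∈ B, sgn (flipAt x F y) = ∑ y ∈ B, sgn (F y) := fun F =>
    Finset.sum_congr rfl fun y hy => by rw [flipAt_ne (ne_of_mem_of_not_mem hy hx)]
  simp only [h2, flipAt_self, sgn_not, neg_mul, Finset.sum_neg_distrib] at h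
  linarith

lemma sum_signs_eq_zero (B : Finset X) : ∑ F : X → Bool, ∑ y ∈ B, sgn (F y) = 0 := by
  rw [Finset.sum_comm]
  refine Finset.sum_eq_zero fun y _ => ?_
  simpa using sum_sgn_mul_eq_zero (Finset.notMem_empty y) (fun _ => 1)

lemma sum_signs_sq (B : Finset X) :
    ∑ F : X → Bool, (∑ y ∈ B, sgn (F y)) ^ 2 = B.card * Fintype.card (X → Bool) := by
  induction B using Finset.induction_on with
  | empty => simp
  | insert x B hx ih =>
    have h : ∀ F : X → Bool, (∑ y ∈ insert x B, sgn (F y)) ^ 2 =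
        1 + 2 * (sgn (F x) * ∑ y ∈ B, sgn (F y)) + (∑ y ∈ B, sgn (F y)) ^ 2 := fun F => by
      rw [Finset.sum_insert hx]
      linear_combination sgn_mul_self (F x)
    simp only [h, Finset.sum_add_distrib, ← Finset.mul_sum, ih,
      sum_sgn_mul_eq_zero hx (fun s => s), Finset.card_insert_of_notMem hx]
    simp
    ring

lemma sum_signs_pow_four_le (B : Finset X) :
    ∑ F : X → Bool, (∑ y ∈ B, sgn (F y)) ^ 4 ≤ 3 * (B.card : ℝ) ^ 2 * Fintype.card (X → Bool) := by
  induction B using Finset.induction_on with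
  | empty => simp
  | insert x B hx ih =>
    have h : ∀ F : X → Bool, (∑ y ∈ insert x B, sgn (F y)) ^ 4 =
        1 + 4 * (sgn (F x) * ∑ y ∈ B, sgn (F y)) + 6 * (∑ y ∈ B, sgn (F y)) ^ 2 +
        4 * (sgn (F x) * (∑ y ∈ B, sgn (F y)) ^ 3) + (∑ y ∈ B, sgn (F y)) ^ 4 := fun F => by
      rw [Finset.sum_insert hx]
      have := sgn_mul_self (F x)
      set a := sgn (F x)
      set s := ∑ y ∈ B, sgn (F y)
      linear_combination (a * a + 1 + 4 * a * s + 6 * s ^ 2) * this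
    simp only [h, Finset.sum_add_distrib, ← Finset.mul_sum, sum_signs_sq,
      sum_sgn_mul_eq_zero hx (fun s => s), sum_sgn_mul_eq_zero hx (fun s => s ^ 3),
      Finset.card_insert_of_notMem hx]
    have hK : (0 : ℝ) ≤ Fintype.card (X → Bool) := by positivity
    push_cast at ih ⊢
    simp only [Finset.sum_const, Finset.card_univ, nsmul_eq_mul]
    nlinarith

/-- The absolute value of a sum of `σ²` random signs has mean at least `9σ/16`. -/
lemma le_sum_abs_signs (B : Finset X) {σ : ℝ} (hσ : 0 < σ) (hB : (B.card : ℝ) = σ ^ 2) :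
    9 / 16 * σ * Fintype.card (X → Bool) ≤ ∑ F : X → Bool, |∑ y ∈ B, sgn (F y)| := by
  -- `u (u - 1)² (u + 2) ≥ 0` for `u = |s| / (2σ)`
  have h : ∀ s : ℝ, (12 * σ ^ 2 * s ^ 2 - s ^ 4) / (16 * σ ^ 3) ≤ |s| := fun s => by
    rw [div_le_iff₀ (by positivity), ← sq_abs s, show s ^ 4 = |s| ^ 4 by
      rw [show (4 : ℕ) = 2 * 2 from rfl, pow_mul, pow_mul, sq_abs]]
    have h1 : 0 ≤ |s| * (|s| - 2 * σ) ^ 2 * (|s| + 4 * σ) := by positivity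
    nlinarith
  refine le_trans ?_ (Finset.sum_le_sum fun F _ => h (∑ y ∈ B, sgn (F y)))
  rw [← Finset.sum_div, Finset.sum_sub_distrib, ← Finset.mul_sum, sum_signs_sq,
    le_div_iff₀ (by positivity)]
  have h4 := sum_signs_pow_four_le B
  rw [hB] at h4 ⊢
  nlinarith

/-- If `r` random signs are added to a constant `a`, the absolute value of the sum has mean at
most `a + r σ` whenever `σ² = 1 / (a + r)`. -/
lemma sum_abs_add_signs_le (B : Finset X) {a σ : ℝ} (ha : 0 ≤ a) (hσ : 0 < σ) (hσ2 : σ ≤ 2)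
    (h1 : (a + B.card) * σ ^ 2 = 1) :
    ∑ F : X → Bool, |a + ∑ y ∈ B, sgn (F y)| ≤ (a + B.card * σ) * Fintype.card (X → Bool) := by
  set r : ℝ := (B.card : ℝ) with hr
  have hr0 : 0 ≤ r := by positivity
  have hc : 0 < a + r * σ := by
    rcases hr0.eq_or_lt with h | h
    · have : a ≠ 0 := fun h0 => by rw [h0, ← h] at h1; norm_num at h1
      have := lt_of_le_of_ne ha this.symm
      rw [← h]
      linarith
    · positivity
  set c := a + r * σ with hcdef
  have hac : a ^ 2 + r ≤ c ^ 2 := by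
    have e : r = r * ((a + r) * σ ^ 2) := by rw [h1, mul_one]
    have : 0 ≤ a * r * σ * (2 - σ) := 
      mul_nonneg (mul_nonneg (mul_nonneg ha hr0) hσ.le) (by linarith)
    nlinarith
  have h : ∀ s : ℝ, |s| ≤ (s ^ 2 + c ^ 2) / (2 * c) := fun s => by
    rw [le_div_iff₀ (by positivity), ← sq_abs s]
    nlinarith [sq_nonneg (|s| - c)]
  refine (Finset.sum_le_sum fun F _ => h _).trans ?_
  have e : ∀ F : X → Bool, (a + ∑ y ∈ B, sgn (F y)) ^ 2 + c ^ 2 =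
      (a ^ 2 + c ^ 2) + 2 * a * (∑ y ∈ B, sgn (F y)) + (∑ y ∈ B, sgn (F y)) ^ 2 := fun F => by ring
  rw [← Finset.sum_div, div_le_iff₀ (by positivity)]
  simp only [e, Finset.sum_add_distrib, ← Finset.mul_sum, sum_signs_eq_zero, sum_signs_sq,
    Finset.sum_const, Finset.card_univ, nsmul_eq_mul]
  rw [← hr]
  have hK : (0 : ℝ) ≤ Fintype.card (X → Bool) := by positivity
  nlinarith

end Moments

/-! ### Concentration of functions of random bits -/

lemma sq_sum_fin_bool_le (m : ℕ) {c : ℝ} : ∀ (G : (Fin m → Bool) → ℝ),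
    (∀ F i, |G (flipAt i F) - G F| ≤ c) →
    2 ^ m * ∑ F, G F ^ 2 - (∑ F, G F) ^ 2 ≤ 4 ^ m * (m * c ^ 2 / 4) := by
  induction m with
  | zero => intro G _; simp
  | succ m ih =>
    intro G hG
    have split : ∀ H : (Fin (m + 1) → Bool) → ℝ,
        ∑ F, H F = ∑ F : Fin m → Bool, H (Fin.cons true F) +
          ∑ F : Fin m → Bool, H (Fin.cons false F) := fun H => by
      rw [← (Fin.consEquiv (fun _ => Bool)).sum_comp, Fintype.sum_prod_type]
      simp [Fin.consEquiv]
    have hcons : ∀ b F i, (flipAt (Fin.succ i) (Fin.cons b F : Fin (m + 1) → Bool)) =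
        Fin.cons b (flipAt i F) := fun b F i => by
      ext j
      refine Fin.cases ?_ (fun j => ?_) j
      · rw [flipAt_ne (Fin.succ_ne_zero i).symm]; simp
      · by_cases h : j = i
        · subst h; simp [flipAt_self]
        · rw [flipAt_ne (by simpa using h)]; simp [flipAt_ne h]
    have h1 := ih (fun F => G (Fin.cons true F)) fun F i => by
      simpa only [hcons] using hG (Fin.cons true F) i.succ
    have h0 := ih (fun F => G (Fin.cons false F)) fun F i => by
      simpa only [hcons] using hG (Fin.cons false F) i.succ
    have hd : |∑ F : Fin m → Bool, G (Fin.cons true F) -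
        ∑ F : Fin m → Bool, G (Fin.cons false F)| ≤ 2 ^ m * c := by
      rw [← Finset.sum_sub_distrib]
      refine (Finset.abs_sum_le_sum_abs _ _).trans ?_
      refine (Finset.sum_le_sum (g := fun _ => c) fun F _ => ?_).trans (by simp)
      have := hG (Fin.cons false F) 0
      rwa [show flipAt 0 (Fin.cons false F : Fin (m + 1) → Bool) = Fin.cons true F by
        ext j
        refine Fin.cases ?_ (fun j => ?_) j
        · simp [flipAt_self]
        · rw [flipAt_ne (Fin.succ_ne_zero j)]; simp] at this
    have hd2 := sq_le_sq' (abs_le.1 hd).1 (abs_le.1 hd).2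
    rw [split G, split (fun F => G F ^ 2)]
    push_cast
    have e4 : (4 : ℝ) ^ m = (2 ^ m) ^ 2 := by rw [← pow_mul, mul_comm, pow_mul]; norm_num
    simp only [pow_succ (2 : ℝ) m, pow_succ (4 : ℝ) m, e4] at *
    nlinarith

section Concentration

variable {X : Type*} [Fintype X] [DecidableEq X]

/-- The Efron–Stein inequality for bounded differences: if negating one of the bits changes `G` by
at most `c`, then `G` has variance at most `|X| c² / 4`. -/
lemma sum_sq_sub_mean_le {c : ℝ} (G : (X → Bool) → ℝ) (hG : ∀ F x, |G (flipAt x F) - G F| ≤ c)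
    {μ : ℝ} (hμ : ∑ F, G F = μ * Fintype.card (X → Bool)) :
    ∑ F, (G F - μ) ^ 2 ≤ Fintype.card (X → Bool) * (Fintype.card X * c ^ 2 / 4) := by
  set m := Fintype.card X
  let e : X ≃ Fin m := Fintype.equivFin X
  let E : (X → Bool) ≃ (Fin m → Bool) := e.arrowCongr (Equiv.refl Bool)
  have hK : (Fintype.card (X → Bool) : ℝ) = 2 ^ m := by simp [m]
  have h := sq_sum_fin_bool_le m (c := c) (fun F => G (E.symm F)) fun F i => by
    have : E.symm (flipAt i F) = flipAt (e.symm i) (E.symm F) := by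
      ext x
      by_cases hx : x = e.symm i
      · subst hx; simp [E, flipAt_self]
      · rw [flipAt_ne hx]
        have hx' : e x ≠ i := fun h => hx (by simp [← h])
        simp [E, flipAt_ne hx']
    rw [this]
    exact hG _ _
  rw [E.symm.sum_comp G, E.symm.sum_comp (fun F => G F ^ 2), hμ] at h
  have e1 : ∑ F, (G F - μ) ^ 2 = ∑ F, G F ^ 2 - 2 ^ m * μ ^ 2 := by
    have : ∀ F, (G F - μ) ^ 2 = G F ^ 2 - 2 * μ * G F + μ ^ 2 := fun F => by ring
    simp only [this, Finset.sum_add_distrib, Finset.sum_sub_distrib, ← Finset.mul_sum, hμ,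
      Finset.sum_const, Finset.card_univ, nsmul_eq_mul]
    rw [hK]; ring
  rw [e1, hK]
  rw [hK, show (4 : ℝ) ^ m = 2 ^ m * 2 ^ m by rw [← mul_pow]; norm_num] at h
  have h2 : (0 : ℝ) < 2 ^ m := by positivity
  refine le_of_mul_le_mul_left ?_ h2
  nlinarith

open Classical in
/-- Chebyshev's inequality for a function with bounded differences. -/
lemma card_deviation_le {c τ : ℝ} (hτ : 0 < τ) (G : (X → Bool) → ℝ)
    (hG : ∀ F x, |G (flipAt x F) - G F| ≤ c) {μ : ℝ}
    (hμ : ∑ F, G F = μ * Fintype.card (X → Bool)) :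
    ((Finset.univ.filter fun F => τ ≤ |G F - μ|).card : ℝ) ≤
      Fintype.card (X → Bool) * (Fintype.card X * c ^ 2 / (4 * τ ^ 2)) := by
  have h := sum_sq_sub_mean_le G hG hμ
  have h2 : ((Finset.univ.filter fun F => τ ≤ |G F - μ|).card : ℝ) * τ ^ 2 ≤
      ∑ F, (G F - μ) ^ 2 := by
    rw [← nsmul_eq_mul]
    refine (Finset.card_nsmul_le_sum _ (fun F => (G F - μ) ^ 2) _ fun F hF => ?_).trans
      (Finset.sum_le_sum_of_subset_of_nonneg (Finset.filter_subset _ _) fun _ _ _ => sq_nonneg _)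
    rw [← sq_abs (G F - μ)]
    exact pow_le_pow_left₀ hτ.le (Finset.mem_filter.1 hF).2 2
  have h3 : ((Finset.univ.filter fun F => τ ≤ |G F - μ|).card : ℝ) ≤
      Fintype.card (X → Bool) * (Fintype.card X * c ^ 2 / 4) / τ ^ 2 := by
    rw [le_div_iff₀ (by positivity)]
    exact h2.trans h
  refine h3.trans (le_of_eq ?_)
  field_simp

end Concentration

/-! ### Distance to juntas and the bias on subcubes -/

section Bias

variable {n : ℕ}

/-- The subcube of the points whose coordinates in `S` are given by `u`. -/
def cell (S : Finset (Fin n)) (u : S → Bool) : Finset (Fin n → Bool) :=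
  Finset.univ.filter fun x => S.restrict x = u

lemma mem_cell {S : Finset (Fin n)} {u : S → Bool} {x : Fin n → Bool} :
    x ∈ cell S u ↔ S.restrict x = u := by simp [cell]

/-- The sum of the absolute biases of `f` on the subcubes on which the coordinates in `S` are
fixed. -/
def totalBias (S : Finset (Fin n)) (f : BoolFun n) : ℝ :=
  ∑ u : S → Bool, |∑ x ∈ cell S u, sgn (f x)|

lemma sum_cells (S : Finset (Fin n)) (φ : (Fin n → Bool) → ℝ) :
    ∑ u : S → Bool, ∑ x ∈ cell S u, φ x = ∑ x, φ x :=
  Finset.sum_fiberwise Finset.univ S.restrict φ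

lemma card_cell {S : Finset (Fin n)} {l : ℕ} (hS : S.card + l = n) (u : S → Bool) :
    (cell S u).card = 2 ^ l := by
  have : cell S u = Fintype.piFinset fun i => if h : i ∈ S then {u ⟨i, h⟩} else Finset.univ := by
    ext x
    simp only [mem_cell, Fintype.mem_piFinset, funext_iff, Finset.restrict]
    constructor
    · intro h i
      by_cases hi : i ∈ S
      · simpa [hi] using h ⟨i, hi⟩
      · simp [hi]
    · rintro h ⟨i, hi⟩
      simpa [hi] using h i
  rw [this, Fintype.card_piFinset]
  have h2 : ∀ i : Fin n, (if h : i ∈ S then {u ⟨i, h⟩} else (Finset.univ : Finset Bool)).card =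
      if i ∈ Sᶜ then 2 else 1 := fun i => by by_cases hi : i ∈ S <;> simp [hi]
  rw [Finset.prod_congr rfl fun i _ => h2 i, Finset.prod_ite_mem, Finset.univ_inter,
    Finset.prod_const, Finset.card_compl, Fintype.card_fin]
  congr 1
  omega

lemma two_mul_hammingDist (f g : BoolFun n) :
    2 * (hammingDist f g : ℝ) = 2 ^ n - ∑ x, sgn (f x) * sgn (g x) := by
  have h : ∀ x, sgn (f x) * sgn (g x) = 1 - 2 * if f x ≠ g x then 1 else 0 := fun x => by
    cases f x <;> cases g x <;> norm_num [sgn]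
  simp only [h, Finset.sum_sub_distrib, ← Finset.mul_sum, Finset.sum_boole]
  simp [hammingDist]

lemma le_hammingDist_of_dependsOn {S : Finset (Fin n)} (f : BoolFun n) {g : BoolFun n}
    (hg : DependsOn g (S : Set (Fin n))) :
    2 ^ n - totalBias S f ≤ 2 * (hammingDist f g : ℝ) := by
  rw [two_mul_hammingDist, ← sum_cells S, totalBias]
  refine sub_le_sub_left (Finset.sum_le_sum fun u _ => ?_) _
  rcases (cell S u).eq_empty_or_nonempty with h | ⟨y, hy⟩
  · simp [h]
  have : ∀ x ∈ cell S u, sgn (f x) * sgn (g x) = sgn (f x) * sgn (g y) := fun x hx => by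
    rw [@hg x y fun i hi => ?_]
    exact congrFun ((mem_cell.1 hx).trans (mem_cell.1 hy).symm) ⟨i, hi⟩
  rw [Finset.sum_congr rfl this, ← Finset.sum_mul]
  refine (le_abs_self _).trans (le_of_eq ?_)
  rw [abs_mul, abs_sgn, mul_one]

lemma exists_dependsOn_hammingDist (S : Finset (Fin n)) (f : BoolFun n) :
    ∃ g : BoolFun n, DependsOn g (S : Set (Fin n)) ∧
      2 * (hammingDist f g : ℝ) = 2 ^ n - totalBias S f := by
  refine ⟨fun x => decide (∑ y ∈ cell S (S.restrict x), sgn (f y) < 0), fun x y hxy => ?_, ?_⟩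
  · have : S.restrict x = S.restrict y := funext fun i => hxy i i.2
    simp only [this]
  rw [two_mul_hammingDist, ← sum_cells S, totalBias]
  congr 1
  refine Finset.sum_congr rfl fun u _ => ?_
  have : ∀ x ∈ cell S u, sgn (f x) * sgn (decide (∑ y ∈ cell S (S.restrict x), sgn (f y) < 0)) =
      sgn (f x) * sgn (decide (∑ y ∈ cell S u, sgn (f y) < 0)) := fun x hx => by
    rw [mem_cell.1 hx]
  rw [Finset.sum_congr rfl this, ← Finset.sum_mul]
  by_cases h : ∑ y ∈ cell S u, sgn (f y) < 0
  · rw [decide_eq_true h, abs_of_neg h]; simp [sgn]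
  · rw [decide_eq_false h, abs_of_nonneg (not_lt.1 h)]; simp [sgn]

lemma abs_totalBias_sub_le (S : Finset (Fin n)) (f f' : BoolFun n) :
    |totalBias S f - totalBias S f'| ≤ 2 * (hammingDist f f' : ℝ) := by
  have h : ∀ x, |sgn (f x) - sgn (f' x)| = 2 * if f x ≠ f' x then 1 else 0 := fun x => by
    cases f x <;> cases f' x <;> norm_num [sgn]
  calc |totalBias S f - totalBias S f'|
      ≤ ∑ u : S → Bool, ∑ x ∈ cell S u, |sgn (f x) - sgn (f' x)| := by
        rw [totalBias, totalBias, ← Finset.sum_sub_distrib]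
        refine (Finset.abs_sum_le_sum_abs _ _).trans (Finset.sum_le_sum fun u _ => ?_)
        refine (abs_abs_sub_abs_le_abs_sub _ _).trans ?_
        rw [← Finset.sum_sub_distrib]
        exact Finset.abs_sum_le_sum_abs _ _
    _ = 2 * (hammingDist f f' : ℝ) := by
        rw [sum_cells S]
        simp only [h, ← Finset.mul_sum, Finset.sum_boole]
        simp [hammingDist]

lemma isFarFromJuntas_of_totalBias_le {k : ℕ} (hk : k ≤ n) {ε : ℝ} {f : BoolFun n}
    (h : ∀ S : Finset (Fin n), S.card = k → totalBias S f ≤ 2 ^ n - 2 * (ε * 2 ^ n)) :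
    IsFarFromJuntas k ε f := by
  rintro g ⟨S, hS, hg⟩
  obtain ⟨S', hSS', hS'⟩ := Finset.exists_superset_card_eq hS (by simpa using hk)
  have := le_hammingDist_of_dependsOn f (hg.mono (Finset.coe_subset.2 hSS'))
  linarith [h S' hS']

lemma isCloseToJunta_of_le_totalBias {k : ℕ} {ε : ℝ} {f : BoolFun n} {S : Finset (Fin n)}
    (hS : S.card ≤ k) (h : 2 ^ n - 2 * (ε * 2 ^ n) ≤ totalBias S f) : IsCloseToJunta k ε f := by
  obtain ⟨g, hg, hd⟩ := exists_dependsOn_hammingDist S f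
  exact ⟨g, ⟨S, hS, hg⟩, by linarith⟩

/-! ### Random functions on a region -/

/-- The function that agrees with `F` on the region `R` and vanishes outside of it. -/
def mask (R : Finset (Fin n → Bool)) (F : BoolFun n) : BoolFun n :=
  fun x => decide (x ∈ R) && F x

lemma sum_cell_mask (R : Finset (Fin n → Bool)) (F : BoolFun n) (B : Finset (Fin n → Bool)) :
    ∑ x ∈ B, sgn (mask R F x) =
      (B.filter (· ∉ R)).card + ∑ x ∈ B.filter (· ∈ R), sgn (F x) := by
  rw [← Finset.sum_filter_add_sum_filter_not B (· ∈ R), add_comm]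
  congr 1
  · rw [Finset.card_eq_sum_ones, Nat.cast_sum]
    refine Finset.sum_congr rfl fun x hx => ?_
    simp [mask, (Finset.mem_filter.1 hx).2, sgn]
  · refine Finset.sum_congr rfl fun x hx => ?_
    simp [mask, (Finset.mem_filter.1 hx).2]

lemma hammingDist_mask_le (R : Finset (Fin n → Bool)) (F F' : BoolFun n) :
    hammingDist (mask R F) (mask R F') ≤ hammingDist F F' := by
  refine Finset.card_le_card (Finset.monotone_filter_right _ fun x _ h h' => h ?_)
  simp [mask, h']

lemma sum_cells_region (S : Finset (Fin n)) (R : Finset (Fin n → Bool)) (β : ℝ) :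
    ∑ u : S → Bool, ((((cell S u).filter (· ∉ R)).card : ℝ) +
      ((cell S u).filter (· ∈ R)).card * β) = 2 ^ n - R.card + R.card * β := by
  have h : ∀ u : S → Bool, (((cell S u).filter (· ∉ R)).card : ℝ) +
      ((cell S u).filter (· ∈ R)).card * β =
      ∑ x ∈ cell S u, (1 + (β - 1) * if x ∈ R then 1 else 0) := fun u => by
    rw [Finset.sum_add_distrib, ← Finset.mul_sum, Finset.sum_boole]
    simp only [Finset.sum_const, nsmul_eq_mul, mul_one]
    rw [← Finset.card_filter_add_card_filter_not (s := cell S u) (· ∈ R)]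
    push_cast
    ring
  rw [Finset.sum_congr rfl fun u _ => h u, sum_cells S, Finset.sum_add_distrib, ← Finset.mul_sum,
    Finset.sum_boole]
  simp
  ring

lemma abs_totalBias_mask_flipAt_le (S : Finset (Fin n)) (R : Finset (Fin n → Bool))
    (F : BoolFun n) (x : Fin n → Bool) :
    |totalBias S (mask R (flipAt x F)) - totalBias S (mask R F)| ≤ 2 := by
  refine (abs_totalBias_sub_le S _ _).trans ?_
  have h : hammingDist (flipAt x F) F ≤ 1 := by
    refine (Finset.card_le_card (t := {x}) fun y => ?_).trans (by simp)
    simp only [Finset.mem_filter, Finset.mem_univ, true_and, Finset.mem_singleton]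
    exact fun h => by_contra fun h' => h (flipAt_ne h' F)
  have : (hammingDist (mask R (flipAt x F)) (mask R F) : ℝ) ≤ 1 := by
    exact_mod_cast (hammingDist_mask_le R _ _).trans h
  linarith

/-- The mean of the total bias of a random function on `R`. The number `σ` is `2 ^ (-l / 2)`. -/
lemma sum_totalBias_mask_le {S : Finset (Fin n)} {l : ℕ} (hS : S.card + l = n)
    (R : Finset (Fin n → Bool)) {σ : ℝ} (hσ : 0 < σ) (hσ2 : σ ≤ 2) (hl : 2 ^ l * σ ^ 2 = 1) :
    ∑ F : BoolFun n, totalBias S (mask R F) ≤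
      (2 ^ n - R.card + R.card * σ) * Fintype.card (BoolFun n) := by
  simp only [totalBias]
  rw [Finset.sum_comm, ← sum_cells_region S R σ, Finset.sum_mul]
  refine Finset.sum_le_sum fun u _ => ?_
  simp only [sum_cell_mask]
  refine sum_abs_add_signs_le _ (by positivity) hσ hσ2 ?_
  rw [← Nat.cast_add, add_comm, Finset.card_filter_add_card_filter_not, card_cell hS]
  exact_mod_cast hl

open Classical in
/-- A random function on `R` is most likely far from all juntas: the bias with respect to each set
of `k` variables is concentrated, and the union bound applies. -/
lemma card_not_isFarFromJuntas_le {k l : ℕ} (hn : k + l = n) (R : Finset (Fin n → Bool))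
    {σ τ ε : ℝ} (hσ : 0 < σ) (hσ2 : σ ≤ 2) (hl : 2 ^ l * σ ^ 2 = 1) (hτ : 0 < τ)
    (hε : 2 * (ε * 2 ^ n) ≤ R.card * (1 - σ) - τ) :
    ((Finset.univ.filter fun F : BoolFun n => ¬ IsFarFromJuntas k ε (mask R F)).card : ℝ) ≤
      n.choose k * (Fintype.card (BoolFun n) * (2 ^ n / τ ^ 2)) := by
  have hK : (0 : ℝ) < Fintype.card (BoolFun n) := by positivity
  let μ : Finset (Fin n) → ℝ := fun S =>
    (∑ F : BoolFun n, totalBias S (mask R F)) / Fintype.card (BoolFun n)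
  have hμ : ∀ S, ∑ F : BoolFun n, totalBias S (mask R F) = μ S * Fintype.card (BoolFun n) :=
    fun S => (div_mul_cancel₀ _ hK.ne').symm
  have hsub : (Finset.univ.filter fun F : BoolFun n => ¬ IsFarFromJuntas k ε (mask R F)) ⊆
      (Finset.powersetCard k Finset.univ).biUnion fun S =>
        Finset.univ.filter fun F => τ ≤ |totalBias S (mask R F) - μ S| := by
    intro F hF
    simp only [Finset.mem_filter, Finset.mem_univ, true_and] at hF
    have : ∃ S : Finset (Fin n), S.card = k ∧
        2 ^ n - 2 * (ε * 2 ^ n) < totalBias S (mask R F) := by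
      by_contra! h
      exact hF (isFarFromJuntas_of_totalBias_le (by omega) h)
    obtain ⟨S, hS, hb⟩ := this
    simp only [Finset.mem_biUnion, Finset.mem_powersetCard, Finset.mem_filter, Finset.mem_univ,
      true_and, Finset.subset_univ]
    refine ⟨S, hS, le_trans ?_ (le_abs_self _)⟩
    have h1 : μ S ≤ 2 ^ n - R.card + R.card * σ :=
      (div_le_iff₀ hK).2 (sum_totalBias_mask_le (hS ▸ hn) R hσ hσ2 hl)
    linarith
  refine (Nat.cast_le.2 ((Finset.card_le_card hsub).trans Finset.card_biUnion_le)).trans ?_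
  push_cast
  refine (Finset.sum_le_card_nsmul _ _ _ fun S _ => card_deviation_le hτ _
    (abs_totalBias_mask_flipAt_le S R) (hμ S)).trans (le_of_eq ?_)
  rw [Finset.card_powersetCard, nsmul_eq_mul]
  simp
  field_simp
  norm_num

/-! ### Random functions that factor through a map -/

lemma sum_cell_comp {S : Finset (Fin n)} {r : (Fin n → Bool) → (Fin n → Bool)} {h : ℕ}
    (hrS : ∀ x, S.restrict (r x) = S.restrict x)
    (hr : ∀ x, (Finset.univ.filter fun y => r y = r x).card = h) (u : S → Bool)
    (φ : (Fin n → Bool) → ℝ) :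
    ∑ x ∈ cell S u, φ (r x) = h * ∑ z ∈ (cell S u).image r, φ z := by
  rw [Finset.sum_comp, Finset.mul_sum]
  refine Finset.sum_congr rfl fun z hz => ?_
  obtain ⟨x, hx, rfl⟩ := Finset.mem_image.1 hz
  rw [nsmul_eq_mul, ← hr x]
  congr 3
  ext y
  simp only [Finset.mem_filter, Finset.mem_univ, true_and, and_iff_right_iff_imp, mem_cell]
  intro hy
  rw [← hrS, hy, hrS]
  exact mem_cell.1 hx

/-- The mean of the total bias of a random function that is constant on the fibres of `r`, all of
which have `h` elements and lie in subcubes: such a function has `σ² = 2 ^ l / h` independent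
values on each subcube. -/
lemma le_sum_totalBias_mask_comp {S : Finset (Fin n)} {l : ℕ} (hS : S.card + l = n)
    {R : Finset (Fin n → Bool)} (hR : ∀ x y, S.restrict x = S.restrict y → x ∈ R → y ∈ R)
    {r : (Fin n → Bool) → (Fin n → Bool)} {h : ℕ}
    (hrS : ∀ x, S.restrict (r x) = S.restrict x)
    (hr : ∀ x, (Finset.univ.filter fun y => r y = r x).card = h)
    {σ β : ℝ} (hσ : 0 < σ) (hl : (2 : ℝ) ^ l = h * σ ^ 2)
    (hβ : σ * β = 9 / 16) :
    (2 ^ n - R.card + R.card * β) * Fintype.card (BoolFun n) ≤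
      ∑ F : BoolFun n, totalBias S (mask R (F ∘ r)) := by
  simp only [totalBias]
  rw [Finset.sum_comm, ← sum_cells_region S R β, Finset.sum_mul]
  refine Finset.sum_le_sum fun u _ => ?_
  simp only [sum_cell_mask]
  by_cases hu : ∃ x ∈ cell S u, x ∈ R
  · obtain ⟨x, hx, hxR⟩ := hu
    have hall : ∀ y ∈ cell S u, y ∈ R := fun y hy =>
      hR x y ((mem_cell.1 hx).trans (mem_cell.1 hy).symm) hxR
    rw [Finset.filter_true_of_mem hall, Finset.filter_false_of_mem fun y hy => not_not.2 (hall y hy)]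
    simp only [Finset.card_empty, Nat.cast_zero, zero_add, Function.comp_apply]
    have hh : (0 : ℝ) < h := by
      by_contra! hh
      have h1 : (0 : ℝ) < 2 ^ l := by positivity
      have h2 : (h : ℝ) * σ ^ 2 ≤ 0 := mul_nonpos_of_nonpos_of_nonneg hh (by positivity)
      linarith
    have hcard : (((cell S u).image r).card : ℝ) = σ ^ 2 := by
      have h1 := sum_cell_comp hrS hr u (fun _ => 1)
      simp only [Finset.sum_const, nsmul_eq_mul, mul_one, card_cell hS] at h1
      push_cast at h1
      rw [hl] at h1
      exact (mul_left_cancel₀ hh.ne' h1).symm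
    have h3 : ∀ F : BoolFun n, |∑ x ∈ cell S u, sgn (F (r x))| =
        h * |∑ z ∈ (cell S u).image r, sgn (F z)| := fun F => by
      rw [sum_cell_comp hrS hr u (fun z => sgn (F z)), abs_mul, abs_of_pos hh]
    simp only [h3, ← Finset.mul_sum]
    have h4 := mul_le_mul_of_nonneg_left (le_sum_abs_signs _ hσ hcard) hh.le
    refine le_trans (le_of_eq ?_) h4
    rw [card_cell hS]
    push_cast
    rw [hl, ← hβ]
    ring
  · push Not at hu
    rw [Finset.filter_true_of_mem hu, Finset.filter_false_of_mem hu]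
    simp
    rw [mul_comm]

lemma hammingDist_comp_flipAt_le {r : (Fin n → Bool) → (Fin n → Bool)} {h : ℕ}
    (hr : ∀ x, (Finset.univ.filter fun y => r y = r x).card = h) (F : BoolFun n)
    (z : Fin n → Bool) : hammingDist (flipAt z F ∘ r) (F ∘ r) ≤ h := by
  have hsub : (Finset.univ.filter fun y => (flipAt z F ∘ r) y ≠ (F ∘ r) y) ⊆
      Finset.univ.filter fun y => r y = z := fun y => by
    simp only [Finset.mem_filter, Finset.mem_univ, true_and, Function.comp_apply]
    exact fun h => by_contra fun h' => h (flipAt_ne h' F)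
  refine (Finset.card_le_card hsub).trans ?_
  rcases (Finset.univ.filter fun y => r y = z).eq_empty_or_nonempty with h0 | ⟨x, hx⟩
  · simp [h0]
  · rw [← hr x, (Finset.mem_filter.1 hx).2]

open Classical in
/-- A random function that is constant on the fibres of `r` is most likely close to a junta on `S`:
its bias with respect to `S` is concentrated. -/
lemma card_not_isCloseToJunta_le {S : Finset (Fin n)} {k l : ℕ} (hS : S.card + l = n)
    (hSk : S.card ≤ k) {R : Finset (Fin n → Bool)}
    (hR : ∀ x y, S.restrict x = S.restrict y → x ∈ R → y ∈ R)
    {r : (Fin n → Bool) → (Fin n → Bool)} {h : ℕ}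
    (hrS : ∀ x, S.restrict (r x) = S.restrict x)
    (hr : ∀ x, (Finset.univ.filter fun y => r y = r x).card = h)
    {σ β τ ε : ℝ} (hσ : 0 < σ) (hl : (2 : ℝ) ^ l = h * σ ^ 2)
    (hβ : σ * β = 9 / 16) (hτ : 0 < τ)
    (hε : R.card * (1 - β) + τ ≤ 2 * (ε * 2 ^ n)) :
    ((Finset.univ.filter fun F : BoolFun n => ¬ IsCloseToJunta k ε (mask R (F ∘ r))).card : ℝ) ≤
      Fintype.card (BoolFun n) * (2 ^ n * h ^ 2 / τ ^ 2) := by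
  have hK : (0 : ℝ) < Fintype.card (BoolFun n) := by positivity
  set μ : ℝ := (∑ F : BoolFun n, totalBias S (mask R (F ∘ r))) / Fintype.card (BoolFun n) with hμd
  have hμ : ∑ F : BoolFun n, totalBias S (mask R (F ∘ r)) = μ * Fintype.card (BoolFun n) :=
    (div_mul_cancel₀ _ hK.ne').symm
  have hμ1 : 2 ^ n - R.card + R.card * β ≤ μ :=
    (le_div_iff₀ hK).2 (le_sum_totalBias_mask_comp hS hR hrS hr hσ hl hβ)
  have hlip : ∀ (F : BoolFun n) x,
      |totalBias S (mask R (flipAt x F ∘ r)) - totalBias S (mask R (F ∘ r))| ≤ 2 * h :=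
    fun F x => (abs_totalBias_sub_le S _ _).trans <| mul_le_mul_of_nonneg_left
      (Nat.cast_le.2 ((hammingDist_mask_le R _ _).trans (hammingDist_comp_flipAt_le hr F x)))
      zero_le_two
  have hsub : (Finset.univ.filter fun F : BoolFun n => ¬ IsCloseToJunta k ε (mask R (F ∘ r))) ⊆
      Finset.univ.filter fun F => τ ≤ |totalBias S (mask R (F ∘ r)) - μ| := by
    intro F
    simp only [Finset.mem_filter, Finset.mem_univ, true_and]
    contrapose!
    intro hF
    refine isCloseToJunta_of_le_totalBias hSk ?_
    linarith [(abs_lt.1 hF).1]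
  refine (Nat.cast_le.2 (Finset.card_le_card hsub)).trans
    ((card_deviation_le hτ (fun F : BoolFun n => totalBias S (mask R (F ∘ r))) hlip hμ).trans
      (le_of_eq ?_))
  simp
  field_simp
  ring

end Bias

/-! ### Query algorithms cannot see collisions that they do not query -/

section Queries

variable {n : ℕ}

/-- The set of points that the algorithm queries when it is run on `f`. -/
def QueryTree.queries : QueryTree n → BoolFun n → Finset (Fin n → Bool)
  | .halt _, _ => ∅
  | .query x next, f => insert x ((next (f x)).queries f)

lemma QueryTree.card_queries_le (T : QueryTree n) (f : BoolFun n) :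
    (T.queries f).card ≤ T.queryCount f := by
  induction T with
  | halt b => simp [QueryTree.queries]
  | query x next ih =>
    exact (Finset.card_insert_le _ _).trans (Nat.succ_le_succ (ih (f x)))

lemma QueryTree.eq_of_eqOn_queries (T : QueryTree n) {f g : BoolFun n}
    (h : ∀ x ∈ T.queries f, f x = g x) :
    T.verdict f = T.verdict g ∧ T.queries f = T.queries g := by
  induction T with
  | halt b => exact ⟨rfl, rfl⟩
  | query x next ih =>
    have hx : f x = g x := h x (Finset.mem_insert_self _ _)
    have := ih (f x) fun y hy => h y (Finset.mem_insert_of_mem hy)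
    simp only [QueryTree.verdict, QueryTree.queries, ← hx, this.1, this.2, and_self]

/-- A map that is injective on a finite set agrees with a permutation there. -/
lemma exists_perm_eqOn {X : Type*} [Finite X] (Q : Finset X) (r : X → X) :
    ∃ π : Equiv.Perm X, Set.InjOn r Q → ∀ x ∈ Q, π x = r x := by
  classical
  by_cases h : Set.InjOn r Q
  · let e : {x // x ∈ Q} ≃ {y // y ∈ r '' (Q : Set X)} :=
      (Equiv.Set.imageOfInjOn r Q h)
    refine ⟨e.extendSubtype, fun _ x hx => ?_⟩
    rw [Equiv.extendSubtype_apply_of_mem e x hx]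
    rfl
  · exact ⟨1, fun h' => absurd h' h⟩

open Classical in
/-- A random function `F` and its collapse `F ∘ r` look the same to an algorithm that does not query
two points with the same image under `r`. The reason is that, if `r` is injective on the set `Q`
of queries made on `F`, it agrees on `Q` with a permutation `π` of the points; the function
`(F ∘ π⁻¹) ∘ r` then agrees with `F` on `Q`, so that `Q`, `π` and `F` can be recovered from it. -/
lemma card_verdict_le (T : QueryTree n) (R : Finset (Fin n → Bool))
    (r : (Fin n → Bool) → (Fin n → Bool)) (b : Bool) :
    (Finset.univ.filter fun F : BoolFun n => T.verdict (mask R F) = b).card ≤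
      (Finset.univ.filter fun F : BoolFun n => T.verdict (mask R (F ∘ r)) = b).card +
      (Finset.univ.filter fun F : BoolFun n => ¬ Set.InjOn r (T.queries (mask R F))).card := by
  choose π hπ using fun Q : Finset (Fin n → Bool) => exists_perm_eqOn Q r
  let Φ : BoolFun n → BoolFun n := fun F => F ∘ (π (T.queries (mask R F))).symm
  have key : ∀ F, Set.InjOn r (T.queries (mask R F)) →
      T.verdict (mask R F) = T.verdict (mask R (Φ F ∘ r)) ∧
      T.queries (mask R F) = T.queries (mask R (Φ F ∘ r)) := fun F hF => by
    refine T.eq_of_eqOn_queries fun x hx => ?_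
    simp only [mask, Φ, Function.comp_apply]
    rw [← hπ _ hF x hx, Equiv.symm_apply_apply]
  have h1 : (Finset.univ.filter fun F : BoolFun n =>
      T.verdict (mask R F) = b ∧ Set.InjOn r (T.queries (mask R F))).card ≤
      (Finset.univ.filter fun F : BoolFun n => T.verdict (mask R (F ∘ r)) = b).card := by
    refine Finset.card_le_card_of_injOn Φ (fun F hF => ?_) fun F hF F' hF' h => ?_
    · simp only [Finset.coe_filter, Finset.mem_univ, true_and, Set.mem_ofPred_eq] at hF ⊢
      rw [← (key F hF.2).1, hF.1]
    · simp only [Finset.coe_filter, Finset.mem_univ, true_and, Set.mem_ofPred_eq] at hF hF'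
      have hQ : T.queries (mask R F) = T.queries (mask R F') := by
        rw [(key F hF.2).2, (key F' hF'.2).2, h]
      simp only [Φ, hQ] at h
      exact (Equiv.surjective _).injective_comp_right h
  refine le_trans (Finset.card_le_card fun F hF => ?_)
    ((Finset.card_union_le _ _).trans (Nat.add_le_add_right h1 _))
  simp only [Finset.mem_filter, Finset.mem_univ, true_and, Finset.mem_union] at hF ⊢
  tauto

open Classical in
/-- If each pair of points is a collision for at most `M` of the maps `r t`, the collapses along a
random one of these maps look like random functions to an algorithm that makes few queries. -/
lemma card_mul_card_verdict_le {ι : Type*} [Fintype ι] (T : QueryTree n)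
    (R : Finset (Fin n → Bool)) (r : ι → (Fin n → Bool) → (Fin n → Bool)) (b : Bool) {q M : ℕ}
    (hT : ∀ f, T.queryCount f ≤ q)
    (hM : ∀ x y, x ≠ y → (Finset.univ.filter fun t => r t x = r t y).card ≤ M) :
    Fintype.card ι * (Finset.univ.filter fun F : BoolFun n => T.verdict (mask R F) = b).card ≤
      (∑ t, (Finset.univ.filter fun F : BoolFun n => T.verdict (mask R (F ∘ r t)) = b).card) +
      Fintype.card (BoolFun n) * (q ^ 2 * M) := by
  have h1 : ∑ t, (Finset.univ.filter fun F : BoolFun n =>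
      ¬ Set.InjOn (r t) (T.queries (mask R F))).card ≤ Fintype.card (BoolFun n) * (q ^ 2 * M) := by
    have hswap : ∑ t, (Finset.univ.filter fun F : BoolFun n =>
        ¬ Set.InjOn (r t) (T.queries (mask R F))).card =
        ∑ F : BoolFun n, (Finset.univ.filter fun t =>
          ¬ Set.InjOn (r t) (T.queries (mask R F))).card := by
      simp only [Finset.card_filter]
      exact Finset.sum_comm
    rw [hswap]
    refine (Finset.sum_le_card_nsmul _ _ (q ^ 2 * M) fun F _ => ?_).trans (by simp)
    set Q := T.queries (mask R F)
    have hQ : Q.offDiag.card ≤ q ^ 2 := by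
      have hq : Q.card ≤ q := (T.card_queries_le _).trans (hT _)
      rw [Finset.offDiag_card, sq]
      exact (Nat.sub_le _ _).trans (Nat.mul_le_mul hq hq)
    have hsub : (Finset.univ.filter fun t => ¬ Set.InjOn (r t) Q) ⊆
        Q.offDiag.biUnion fun p => Finset.univ.filter fun t => r t p.1 = r t p.2 := by
      intro t ht
      replace ht := (Finset.mem_filter.1 ht).2
      simp only [Set.InjOn] at ht
      push Not at ht
      obtain ⟨x, hx, y, hy, hxy, hne⟩ := ht
      simp only [Finset.mem_biUnion, Finset.mem_offDiag, Finset.mem_filter, Finset.mem_univ,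
        true_and]
      exact ⟨(x, y), ⟨hx, hy, hne⟩, hxy⟩
    refine (Finset.card_le_card hsub).trans (Finset.card_biUnion_le.trans ?_)
    refine (Finset.sum_le_card_nsmul _ _ M fun p hp => hM _ _ (Finset.mem_offDiag.1 hp).2.2).trans ?_
    exact Nat.mul_le_mul_right _ hQ
  refine le_trans ?_ (Nat.add_le_add_left h1 _)
  rw [← Finset.sum_add_distrib, ← smul_eq_mul]
  exact Finset.card_nsmul_le_sum _ _ _ fun t _ => card_verdict_le T R (r t) b

/-! ### Testers on random functions -/

lemma RandomizedAlg.verdictOn_eq_tsum (A : RandomizedAlg n) (f : BoolFun n) (b : Bool) :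
    RandomizedAlg.verdictOn A f b = ∑' T, A T * if T.verdict f = b then 1 else 0 := by
  classical
  rw [RandomizedAlg.verdictOn, PMF.map_apply]
  refine tsum_congr fun T => ?_
  simp [eq_comm]

lemma RandomizedAlg.sum_verdictOn {κ : Type*} (s : Finset κ) (A : RandomizedAlg n)
    (f : κ → BoolFun n) (b : Bool) :
    ∑ i ∈ s, RandomizedAlg.verdictOn A (f i) b =
      ∑' T, A T * ((s.filter fun i => T.verdict (f i) = b).card : ENNReal) := by
  simp only [RandomizedAlg.verdictOn_eq_tsum]
  rw [← Summable.tsum_finsetSum fun _ _ => ENNReal.summable]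
  refine tsum_congr fun T => ?_
  rw [← Finset.mul_sum, Finset.sum_boole]

lemma RandomizedAlg.verdictOn_add (A : RandomizedAlg n) (f : BoolFun n) :
    RandomizedAlg.verdictOn A f true + RandomizedAlg.verdictOn A f false = 1 := by
  have := (RandomizedAlg.verdictOn A f).tsum_coe
  rwa [tsum_fintype, Fintype.sum_bool] at this

/-- The version of `card_mul_card_verdict_le` for randomized algorithms. -/
lemma RandomizedAlg.card_mul_sum_verdictOn_le {ι : Type*} [Fintype ι] (A : RandomizedAlg n)
    (R : Finset (Fin n → Bool)) (r : ι → (Fin n → Bool) → (Fin n → Bool)) (b : Bool) {q M : ℕ}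
    (hA : RandomizedAlg.MakesAtMost A q)
    (hM : ∀ x y, x ≠ y → (Finset.univ.filter fun t => r t x = r t y).card ≤ M) :
    Fintype.card ι * ∑ F : BoolFun n, RandomizedAlg.verdictOn A (mask R F) b ≤
      (∑ t, ∑ F : BoolFun n, RandomizedAlg.verdictOn A (mask R (F ∘ r t)) b) +
      Fintype.card (BoolFun n) * (q ^ 2 * M) := by
  simp only [RandomizedAlg.sum_verdictOn]
  rw [← ENNReal.tsum_mul_left, ← Summable.tsum_finsetSum fun _ _ => ENNReal.summable,
    ← mul_one (Fintype.card (BoolFun n) * (q ^ 2 * M) : ENNReal), ← A.tsum_coe,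
    ← ENNReal.tsum_mul_left, ← ENNReal.tsum_add]
  refine ENNReal.tsum_le_tsum fun T => ?_
  by_cases hT : T ∈ A.support
  · have h := card_mul_card_verdict_le T R r b (hA T hT) hM
    have h' : (Fintype.card ι *
        ((Finset.univ.filter fun F : BoolFun n => T.verdict (mask R F) = b).card : ENNReal)) ≤
      (∑ t, ((Finset.univ.filter fun F : BoolFun n =>
        T.verdict (mask R (F ∘ r t)) = b).card : ENNReal)) +
      Fintype.card (BoolFun n) * (q ^ 2 * M) := by exact_mod_cast h
    rw [← Finset.mul_sum, mul_left_comm, mul_comm _ (A T), ← mul_add]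
    gcongr
  · have : A T = 0 := by simpa [PMF.mem_support_iff] using hT
    simp [this]

open Classical in
/-- If collapses of random functions are mostly close to juntas and random functions are mostly far
from juntas, then a tester makes many queries, because otherwise it rejects both almost equally
often. -/
lemma le_sq_mul_of_isTolerantJuntaTester {ι : Type*} [Fintype ι] {k : ℕ} {ε₁ ε₂ : ℝ}
    {A : RandomizedAlg n} (hA : IsTolerantJuntaTester k ε₁ ε₂ A)
    (R : Finset (Fin n → Bool)) (r : ι → (Fin n → Bool) → (Fin n → Bool)) {q M : ℕ}
    (hq : RandomizedAlg.MakesAtMost A q)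
    (hM : ∀ x y, x ≠ y → (Finset.univ.filter fun t => r t x = r t y).card ≤ M)
    (hclose : ∀ t, ((Finset.univ.filter fun F : BoolFun n =>
      ¬ IsCloseToJunta k ε₁ (mask R (F ∘ r t))).card : ℝ) ≤ Fintype.card (BoolFun n) * (1 / 20))
    (hfar : ((Finset.univ.filter fun F : BoolFun n =>
      ¬ IsFarFromJuntas k ε₂ (mask R F)).card : ℝ) ≤ Fintype.card (BoolFun n) * (1 / 20)) :
    (Fintype.card ι : ℝ) ≤ 4 * (q ^ 2 * M) := by
  let ρ : BoolFun n → ℝ := fun f => (RandomizedAlg.verdictOn A f false).toReal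
  have hne : ∀ f b, RandomizedAlg.verdictOn A f b ≠ ⊤ := fun f b => PMF.apply_ne_top _ _
  have hρ0 : ∀ f, 0 ≤ ρ f := fun f => ENNReal.toReal_nonneg
  have hadd : ∀ f, (RandomizedAlg.verdictOn A f true).toReal + ρ f = 1 := fun f => by
    rw [← ENNReal.toReal_add (hne _ _) (hne _ _), RandomizedAlg.verdictOn_add, ENNReal.toReal_one]
  have h23 : (2 / 3 : ENNReal).toReal = 2 / 3 := by simp
  have hρ1 : ∀ f, ρ f ≤ 1 := fun f => by
    have : 0 ≤ (RandomizedAlg.verdictOn A f true).toReal := ENNReal.toReal_nonneg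
    linarith [hadd f]
  have hmain : (Fintype.card ι : ℝ) * ∑ F : BoolFun n, ρ (mask R F) ≤
      (∑ t, ∑ F : BoolFun n, ρ (mask R (F ∘ r t))) + Fintype.card (BoolFun n) * (q ^ 2 * M) := by
    have h := RandomizedAlg.card_mul_sum_verdictOn_le A R r false hq hM
    have hs : ∀ t, ∑ F : BoolFun n, RandomizedAlg.verdictOn A (mask R (F ∘ r t)) false ≠ ⊤ :=
      fun t => ENNReal.sum_ne_top.2 fun F _ => hne _ _
    have hs2 := ENNReal.sum_ne_top.2 fun t (_ : t ∈ Finset.univ) => hs t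
    have hs3 : (Fintype.card (BoolFun n) * (q ^ 2 * M) : ENNReal) ≠ ⊤ := by
      exact_mod_cast ENNReal.natCast_ne_top (Fintype.card (BoolFun n) * (q ^ 2 * M))
    have h2 := ENNReal.toReal_mono (ENNReal.add_ne_top.2 ⟨hs2, hs3⟩) h
    rw [ENNReal.toReal_add hs2 hs3, ENNReal.toReal_mul, ENNReal.toReal_sum fun t _ => hs t,
      ENNReal.toReal_sum fun F _ => hne _ _] at h2
    simp only [ENNReal.toReal_sum fun (F : BoolFun n) (_ : F ∈ Finset.univ) =>
      hne (mask R (F ∘ r _)) false, ENNReal.toReal_mul, ENNReal.toReal_natCast,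
      ENNReal.toReal_pow] at h2
    exact h2
  have hK : (0 : ℝ) < Fintype.card (BoolFun n) := by positivity
  have hyes : ∀ t, ∑ F : BoolFun n, ρ (mask R (F ∘ r t)) ≤
      Fintype.card (BoolFun n) * (1 / 3 + 1 / 20) := fun t => by
    have h : ∀ F : BoolFun n, ρ (mask R (F ∘ r t)) ≤
        1 / 3 + if ¬ IsCloseToJunta k ε₁ (mask R (F ∘ r t)) then 1 else 0 := fun F => by
      by_cases hF : IsCloseToJunta k ε₁ (mask R (F ∘ r t))
      · have := ENNReal.toReal_mono (hne _ _) (hA.accepts _ hF)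
        rw [h23] at this
        simp only [hF, not_true_eq_false, if_false]
        linarith [hadd (mask R (F ∘ r t))]
      · simp only [hF, not_false_eq_true, if_true]
        linarith [hρ1 (mask R (F ∘ r t))]
    refine (Finset.sum_le_sum fun F _ => h F).trans ?_
    rw [Finset.sum_add_distrib, Finset.sum_boole, Finset.sum_const, Finset.card_univ, nsmul_eq_mul]
    linarith [hclose t]
  have hno : Fintype.card (BoolFun n) * (2 / 3 - 2 / 3 * (1 / 20)) ≤
      ∑ F : BoolFun n, ρ (mask R F) := by
    have h : ∀ F : BoolFun n, 2 / 3 - 2 / 3 * (if ¬ IsFarFromJuntas k ε₂ (mask R F) then 1 else 0) ≤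
        ρ (mask R F) := fun F => by
      by_cases hF : IsFarFromJuntas k ε₂ (mask R F)
      · have := ENNReal.toReal_mono (hne _ _) (hA.rejects _ hF)
        rw [h23] at this
        simp only [hF, not_true_eq_false, if_false]
        linarith
      · simp only [hF, not_false_eq_true, if_true]
        linarith [hρ0 (mask R F)]
    refine le_trans ?_ (Finset.sum_le_sum fun F _ => h F)
    rw [Finset.sum_sub_distrib, ← Finset.mul_sum, Finset.sum_boole, Finset.sum_const,
      Finset.card_univ, nsmul_eq_mul]
    linarith
  have hyes' := Finset.sum_le_card_nsmul Finset.univ _ _ fun t _ => hyes t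
  rw [Finset.card_univ, nsmul_eq_mul] at hyes'
  have hι : (0 : ℝ) ≤ Fintype.card ι := by positivity
  have h5 := mul_le_mul_of_nonneg_left hno hι
  refine le_of_mul_le_mul_left ?_ hK
  nlinarith

/-- An algorithm with at most one query sees the same on all pairs of a function and its negation. -/
lemma verdict_const_of_queryCount_le_one {T : QueryTree n} (hT : ∀ f, T.queryCount f ≤ 1)
    (f g : BoolFun n) :
    ((if T.verdict f = false then 1 else 0) + if T.verdict (fun x => !f x) = false then 1 else 0 :
      ENNReal) =
    (if T.verdict g = false then 1 else 0) + if T.verdict (fun x => !g x) = false then 1 else 0 := by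
  rcases T with b | ⟨x, next⟩
  · rfl
  · have : ∀ b, ∃ a, next b = .halt a := fun b => by
      have h := hT fun _ => b
      rcases hb : next b with a | ⟨y, m⟩
      · exact ⟨a, rfl⟩
      · simp [QueryTree.queryCount, hb] at h
    choose a ha using this
    simp only [QueryTree.verdict, ha]
    cases f x <;> cases g x <;> simp [add_comm]

end Queries

/-! ### Hidden blocks of variables -/

section Blocks

variable {n d b w a : ℕ} (e : Fin n ≃ Fin d ⊕ (Fin b × Fin w × Fin a)) (t : Fin b → Fin w → Fin a)

/-- Negate the variables of the hidden blocks selected by `c`. The variables other than the first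
`d` ones are indexed by triples `(i, l, s)`, and the `i`-th hidden block consists of the variables
`(i, l, t i l)`. -/
def shift (c : Fin b → Bool) (x : Fin n → Bool) : Fin n → Bool := fun j =>
  match e j with
  | .inl _ => x j
  | .inr (i, l, s) => xor (x j) (c i && decide (s = t i l))

/-- The set of the variables in hidden blocks. -/
def hidden : Finset (Fin n) :=
  Finset.univ.image fun p : Fin b × Fin w => e.symm (.inr (p.1, p.2, t p.1 p.2))

lemma shift_shift (c : Fin b → Bool) (x : Fin n → Bool) : shift e t c (shift e t c x) = x := by
  ext j
  simp only [shift]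
  rcases e j with u | ⟨i, l, s⟩ <;> simp

lemma shift_inr (c : Fin b → Bool) (x : Fin n → Bool) (i : Fin b) (l : Fin w) (s : Fin a) :
    shift e t c x (e.symm (.inr (i, l, s))) =
      xor (x (e.symm (.inr (i, l, s)))) (c i && decide (s = t i l)) := by
  simp [shift]

lemma shift_of_notMem_hidden (c : Fin b → Bool) (x : Fin n → Bool) {j : Fin n}
    (hj : j ∉ hidden e t) : shift e t c x j = x j := by
  obtain ⟨y, rfl⟩ := e.symm.surjective j
  rcases y with u | ⟨i, l, s⟩
  · simp [shift]
  · have : s ≠ t i l := by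
      rintro rfl
      exact hj (Finset.mem_image_of_mem (fun p : Fin b × Fin w => e.symm (.inr (p.1, p.2, t p.1 p.2)))
        (Finset.mem_univ (i, l)))
    simp [shift, this]

lemma card_hidden : (hidden e t).card = b * w := by
  rw [hidden, Finset.card_image_of_injective, Finset.card_univ]
  · simp
  · rintro ⟨i, l⟩ ⟨i', l'⟩ h
    simpa using congrArg (fun p => (p.1, p.2.1)) (Sum.inr_injective (e.symm.injective h))

/-- The region where the first `d` variables take values in `Z`. -/
def region (Z : Finset (Fin d → Bool)) : Finset (Fin n → Bool) :=
  Finset.univ.filter fun x => (fun u => x (e.symm (.inl u))) ∈ Z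

lemma card_region (Z : Finset (Fin d → Bool)) :
    (region e Z).card = Z.card * 2 ^ (b * w * a) := by
  let E : (Fin n → Bool) ≃ (Fin d → Bool) × (Fin b × Fin w × Fin a → Bool) :=
    (e.arrowCongr (Equiv.refl Bool)).trans (Equiv.sumArrowEquivProdArrow _ _ _)
  have h : (region e Z).map E.toEmbedding = Z ×ˢ Finset.univ := by
    ext ⟨z, y⟩
    simp only [Finset.mem_map_equiv, region, Finset.mem_filter, Finset.mem_univ, true_and,
      Finset.mem_product, and_true]
    have : (fun u => E.symm (z, y) (e.symm (.inl u))) = z := by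
      ext u; simp [E]
    rw [this]
  rw [← Finset.card_map E.toEmbedding, h, Finset.card_product]
  simp [mul_assoc]

lemma mem_region_of_restrict_eq (Z : Finset (Fin d → Bool))
    (x y : Fin n → Bool) (h : ((hidden e t)ᶜ).restrict x = ((hidden e t)ᶜ).restrict y)
    (hx : x ∈ region e Z) : y ∈ region e Z := by
  have : (fun u => x (e.symm (.inl u))) = fun u => y (e.symm (.inl u)) := funext fun u => by
    refine congrFun h ⟨e.symm (.inl u), ?_⟩
    simp [hidden]
  simp only [region, Finset.mem_filter, Finset.mem_univ, true_and] at hx ⊢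
  rwa [← this]

variable [NeZero w]

/-- The values of the first variables of the hidden blocks. -/
def heads (x : Fin n → Bool) : Fin b → Bool := fun i => x (e.symm (.inr (i, 0, t i 0)))

/-- The representative of `x` modulo the negation of hidden blocks: the one in which the first
variable of each block is `false`. -/
def collapse (x : Fin n → Bool) : Fin n → Bool := shift e t (heads e t x) x

lemma heads_shift (c : Fin b → Bool) (x : Fin n → Bool) :
    heads e t (shift e t c x) = fun i => xor (heads e t x i) (c i) := by
  ext i
  simp [heads, shift_inr]

lemma heads_collapse (x : Fin n → Bool) : heads e t (collapse e t x) = fun _ => false := by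
  ext i
  simp [collapse, heads_shift]

lemma card_fiber_collapse (x : Fin n → Bool) :
    (Finset.univ.filter fun y => collapse e t y = collapse e t x).card = 2 ^ b := by
  have h : (2 : ℕ) ^ b = (Finset.univ : Finset (Fin b → Bool)).card := by simp
  rw [h]
  refine Finset.card_nbij' (heads e t) (fun c => shift e t c (collapse e t x))
    (fun _ _ => Finset.mem_coe.2 (Finset.mem_univ _)) (fun c _ => ?_) (fun y hy => ?_)
    (fun c _ => ?_)
  · have h1 : heads e t (shift e t c (collapse e t x)) = c := by
      rw [heads_shift, heads_collapse]; simp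
    simp only [Finset.coe_filter, Finset.mem_univ, true_and, Set.mem_ofPred_eq]
    rw [collapse, h1, shift_shift]
  · simp only [Finset.coe_filter, Finset.mem_univ, true_and, Set.mem_ofPred_eq] at hy
    rw [← hy]
    exact shift_shift _ _ _ _
  · rw [heads_shift, heads_collapse]; simp

lemma restrict_collapse (x : Fin n → Bool) :
    ((hidden e t)ᶜ).restrict (collapse e t x) = ((hidden e t)ᶜ).restrict x :=
  funext fun j => shift_of_notMem_hidden e t _ x (Finset.mem_compl.1 j.2)

/-- If the hidden blocks are singletons, the representative does not depend on the hidden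
variables. -/
lemma dependsOn_collapse (hw : w = 1) :
    DependsOn (collapse e t) ((hidden e t)ᶜ : Finset (Fin n)) := by
  subst hw
  intro x y hxy
  ext j
  by_cases hj : j ∈ hidden e t
  · obtain ⟨⟨i, l⟩, -, rfl⟩ := Finset.mem_image.1 hj
    obtain rfl : l = 0 := Subsingleton.elim _ _
    exact (congrFun (heads_collapse e t x) i).trans (congrFun (heads_collapse e t y) i).symm
  · rw [collapse, collapse, shift_of_notMem_hidden e t _ x hj, shift_of_notMem_hidden e t _ y hj]
    exact hxy j (by simpa using hj)

variable {e t}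

/-- Two distinct points with the same representative differ exactly in some hidden blocks, and so
they reveal one of these blocks. -/
lemma exists_block_of_collapse_eq {x y : Fin n → Bool} (hxy : x ≠ y)
    (h : collapse e t x = collapse e t y) :
    ∃ i, ∀ l s, x (e.symm (.inr (i, l, s))) ≠ y (e.symm (.inr (i, l, s))) ↔ s = t i l := by
  have hne : heads e t x ≠ heads e t y := fun h' => hxy <| by
    rw [← shift_shift e t (heads e t x) x, ← shift_shift e t (heads e t y) y, ← h']
    rw [collapse, collapse, ← h'] at h
    rw [h]
  obtain ⟨i, hi⟩ := Function.ne_iff.1 hne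
  refine ⟨i, fun l s => ?_⟩
  have h2 := congrFun h (e.symm (.inr (i, l, s)))
  simp only [collapse, shift_inr] at h2
  by_cases hs : s = t i l
  · revert h2 hi
    simp only [hs, decide_true, Bool.and_true, iff_true]
    cases heads e t x i <;> cases heads e t y i <;>
      cases x (e.symm (.inr (i, l, t i l))) <;> cases y (e.symm (.inr (i, l, t i l))) <;> simp
  · simpa [hs] using h2

variable (e)

lemma card_collapse_eq_le {x y : Fin n → Bool} (hxy : x ≠ y) :
    (Finset.univ.filter fun t => collapse e t x = collapse e t y).card ≤
      b * (a ^ w) ^ (b - 1) := by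
  classical
  have hsub : (Finset.univ.filter fun t => collapse e t x = collapse e t y) ⊆
      Finset.univ.biUnion fun i : Fin b => Finset.univ.filter fun t : Fin b → Fin w → Fin a =>
        ∀ l s, x (e.symm (.inr (i, l, s))) ≠ y (e.symm (.inr (i, l, s))) ↔ s = t i l := by
    intro t ht
    obtain ⟨i, hi⟩ := exists_block_of_collapse_eq hxy (Finset.mem_filter.1 ht).2
    simp only [Finset.mem_biUnion, Finset.mem_filter, Finset.mem_univ, true_and]
    exact ⟨i, hi⟩
  refine (Finset.card_le_card hsub).trans (Finset.card_biUnion_le.trans ?_)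
  refine (Finset.sum_le_card_nsmul _ _ ((a ^ w) ^ (b - 1)) fun i _ => ?_).trans (by simp)
  rcases (Finset.univ.filter fun t : Fin b → Fin w → Fin a => ∀ l s,
    x (e.symm (.inr (i, l, s))) ≠ y (e.symm (.inr (i, l, s))) ↔ s = t i l).eq_empty_or_nonempty
    with h0 | ⟨t₀, ht₀⟩
  · simp [h0]
  have hsub2 : (Finset.univ.filter fun t : Fin b → Fin w → Fin a => ∀ l s,
      x (e.symm (.inr (i, l, s))) ≠ y (e.symm (.inr (i, l, s))) ↔ s = t i l) ⊆
      Fintype.piFinset fun i' => if i' ∈ ({i} : Finset (Fin b))ᶜ then Finset.univ else {t₀ i} := by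
    intro t ht
    simp only [Finset.mem_filter, Finset.mem_univ, true_and] at ht ht₀
    rw [Fintype.mem_piFinset]
    intro i'
    by_cases hi' : i' = i
    · subst hi'
      have : t i' = t₀ i' := funext fun l => (ht₀ l _).1 ((ht l _).2 rfl)
      simp [this]
    · simp [hi']
  refine (Finset.card_le_card hsub2).trans (le_of_eq ?_)
  have h2 : ∀ i', (if i' ∈ ({i} : Finset (Fin b))ᶜ then (Finset.univ : Finset (Fin w → Fin a))
      else {t₀ i}).card = if i' ∈ ({i} : Finset (Fin b))ᶜ then a ^ w else 1 := fun i' => by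
    split_ifs <;> simp
  rw [Fintype.card_piFinset, Finset.prod_congr rfl fun i' _ => h2 i', Finset.prod_ite_mem,
    Finset.univ_inter, Finset.prod_const, Finset.card_compl]
  simp

end Blocks

/-! ### Testers make many queries -/

section LowerBound

variable {n d w a k : ℕ} [NeZero w]

open Classical in
lemma pow_le_of_isTolerantJuntaTester {b : ℕ} (e : Fin n ≃ Fin d ⊕ (Fin b × Fin w × Fin a))
    (ha : 0 < a) (hb : 0 < b)
    (R : Finset (Fin n → Bool)) {ε₁ ε₂ : ℝ} {A : RandomizedAlg n}
    (hA : IsTolerantJuntaTester k ε₁ ε₂ A) {q : ℕ} (hq : RandomizedAlg.MakesAtMost A q)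
    (hclose : ∀ t, ((Finset.univ.filter fun F : BoolFun n =>
      ¬ IsCloseToJunta k ε₁ (mask R (F ∘ collapse e t))).card : ℝ) ≤
        Fintype.card (BoolFun n) * (1 / 20))
    (hfar : ((Finset.univ.filter fun F : BoolFun n =>
      ¬ IsFarFromJuntas k ε₂ (mask R F)).card : ℝ) ≤ Fintype.card (BoolFun n) * (1 / 20)) :
    (a : ℝ) ^ w ≤ 4 * b * (q : ℝ) ^ 2 := by
  have h := le_sq_mul_of_isTolerantJuntaTester hA R (hq := hq)
    (M := b * (a ^ w) ^ (b - 1)) (r := fun t => collapse e t)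
    (fun x y hxy => card_collapse_eq_le e hxy) hclose hfar
  simp only [Fintype.card_pi, Fintype.card_fin, Finset.prod_const, Finset.card_univ] at h
  push_cast at h
  have hp : (0 : ℝ) < (a ^ w) ^ (b - 1) := by positivity
  refine le_of_mul_le_mul_right ?_ hp
  rw [← pow_succ', Nat.sub_add_cancel hb]
  linarith

/-- The deviations that are allowed for are `σ / 5` times the number of points. -/
lemma choose_mul_le {σ : ℝ} (hn : k + 16 * w = n) (hσ : 2 ^ (16 * w) * σ ^ 2 = 1)
    (hbig : 2 ^ 41 * (2 * n) ^ (16 * w) ≤ 2 ^ n) :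
    (n.choose k : ℝ) * (2 ^ n / (σ / 5 * 2 ^ n) ^ 2) ≤ 1 / 20 ∧
      (2 : ℝ) ^ n * (2 ^ 16 : ℕ) ^ 2 / (σ / 5 * 2 ^ n) ^ 2 ≤ 1 / 20 := by
  have hc : n.choose k ≤ n ^ (16 * w) := by
    rw [← Nat.choose_symm (by omega : k ≤ n), show n - k = 16 * w by omega]
    exact Nat.choose_le_pow _ _
  have hc' : (n.choose k : ℝ) ≤ (n : ℝ) ^ (16 * w) := by exact_mod_cast hc
  have hbig' : (2 : ℝ) ^ 41 * (2 ^ (16 * w) * n ^ (16 * w)) ≤ 2 ^ n := by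
    rw [← mul_pow]; exact_mod_cast hbig
  have hn1 : (1 : ℝ) ≤ (n : ℝ) ^ (16 * w) := by
    have : 0 < n := by have := NeZero.pos w; omega
    exact one_le_pow₀ (by exact_mod_cast this)
  set N : ℝ := 2 ^ (16 * w)
  set V : ℝ := 2 ^ n
  have hN : 0 < N := by positivity
  have hV : 0 < V := by positivity
  have hs : σ ^ 2 = 1 / N := by field_simp; linarith
  have e1 : (σ / 5 * V) ^ 2 = V ^ 2 / (25 * N) := by
    rw [mul_pow, div_pow, hs]; field_simp; norm_num
  rw [e1]
  constructor
  · rw [show (n.choose k : ℝ) * (V / (V ^ 2 / (25 * N))) = n.choose k * (25 * N) / V by field_simp,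
      div_le_iff₀ hV]
    have := mul_le_mul_of_nonneg_left hc' hN.le
    have h0 : 0 ≤ N * n ^ (16 * w) := by positivity
    nlinarith
  · rw [show V * (2 ^ 16 : ℕ) ^ 2 / (V ^ 2 / (25 * N)) = (2 ^ 16 : ℕ) ^ 2 * (25 * N) / V by
      field_simp, div_le_iff₀ hV]
    have := mul_le_mul_of_nonneg_left hn1 hN.le
    norm_num at hbig' ⊢
    nlinarith

/-- The bound for large gaps between `ε₁` and `ε₂`: collapses along single variables are juntas. -/
lemma pow_le_of_width_one (e : Fin n ≃ Fin d ⊕ (Fin 16 × Fin 1 × Fin a)) (ha : 0 < a)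
    (hn : k + 16 * 1 = n) (hbig : 2 ^ 41 * (2 * n) ^ (16 * 1) ≤ 2 ^ n) {ε₁ ε₂ : ℝ}
    (h1 : 0.01 ≤ ε₁) (h2 : ε₂ ≤ 0.49) {A : RandomizedAlg n}
    (hA : IsTolerantJuntaTester k ε₁ ε₂ A) {q : ℕ} (hq : RandomizedAlg.MakesAtMost A q) :
    (a : ℝ) ^ 1 ≤ 64 * (q : ℝ) ^ 2 := by
  classical
  have hV : (0 : ℝ) < 2 ^ n := by positivity
  have hK : (0 : ℝ) < Fintype.card (BoolFun n) := by positivity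
  have hσ : (2 : ℝ) ^ (16 * 1) * (1 / 256) ^ 2 = 1 := by norm_num
  obtain ⟨hc, -⟩ := choose_mul_le hn hσ hbig
  refine (pow_le_of_isTolerantJuntaTester e ha (by norm_num) Finset.univ hA hq (fun t => ?_) ?_).trans_eq (by norm_num)
  · rw [Finset.filter_false_of_mem]
    · simp
    intro F _
    rw [not_not]
    refine ⟨F ∘ collapse e t, ⟨(hidden e t)ᶜ, ?_, ?_⟩, ?_⟩
    · rw [Finset.card_compl, card_hidden, Fintype.card_fin]; omega
    · exact fun x y hxy => congrArg F (dependsOn_collapse e t rfl hxy)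
    · have : mask Finset.univ (F ∘ collapse e t) = F ∘ collapse e t := by
        ext x; simp [mask]
      rw [this, hammingDist_self, Nat.cast_zero]
      have : 0 ≤ ε₁ := by linarith
      positivity
  · refine (card_not_isFarFromJuntas_le hn Finset.univ (by norm_num) (by norm_num) hσ
      (τ := 1 / 256 / 5 * 2 ^ n) (by positivity) ?_).trans ?_
    · simp only [Finset.card_univ, Fintype.card_pi, Fintype.card_bool, Finset.prod_const,
        Fintype.card_fin]
      push_cast
      nlinarith
    · rw [mul_left_comm]
      exact mul_le_mul_of_nonneg_left hc hK.le

/-- The bound for gaps `ε₂ - ε₁ ≤ σ = 2 ^ (-8 w)`. The region has the least density for which random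
functions are far from juntas. -/
lemma pow_le_of_gap_le (e : Fin n ≃ Fin d ⊕ (Fin 16 × Fin w × Fin a)) (ha : 0 < a)
    (hw : 2 ≤ w) (hd : 8 * w + 3 ≤ d) (hn : k + 16 * w = n)
    (hbig : 2 ^ 41 * (2 * n) ^ (16 * w) ≤ 2 ^ n) {ε₁ ε₂ : ℝ}
    (h1 : 0.01 ≤ ε₁) (h12 : ε₁ < ε₂) (h2 : ε₂ ≤ 0.49) (hgap : (ε₂ - ε₁) * 2 ^ (8 * w) ≤ 1)
    {A : RandomizedAlg n} (hA : IsTolerantJuntaTester k ε₁ ε₂ A) {q : ℕ}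
    (hq : RandomizedAlg.MakesAtMost A q) :
    (a : ℝ) ^ w ≤ 64 * (q : ℝ) ^ 2 := by
  classical
  have hV : (0 : ℝ) < 2 ^ n := by positivity
  have hK : (0 : ℝ) < Fintype.card (BoolFun n) := by positivity
  set s : ℝ := 2 ^ (8 * w) with hs
  have hs0 : 0 < s := by positivity
  have hs16 : (2 : ℝ) ^ 16 ≤ s := pow_le_pow_right₀ (by norm_num) (by omega)
  have hss : (2 : ℝ) ^ (16 * w) = s ^ 2 := by rw [hs, ← pow_mul]; congr 1; ring
  obtain ⟨σ, hσd⟩ : ∃ σ : ℝ, σ = 1 / s := ⟨_, rfl⟩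
  have hσ0 : 0 < σ := by rw [hσd]; positivity
  have hsσ : s * σ = 1 := by rw [hσd]; field_simp
  have hσ16 : σ ≤ 1 / 65536 := by
    rw [hσd]
    exact one_div_le_one_div_of_le (by norm_num) (by norm_num at hs16 ⊢; exact hs16)
  have hσ : (2 : ℝ) ^ (16 * w) * σ ^ 2 = 1 := by rw [hss, ← mul_pow, hsσ, one_pow]
  have hgap' : ε₂ - ε₁ ≤ σ := by rw [hσd, le_div_iff₀ hs0]; exact hgap
  have hD0 : (0 : ℝ) < 2 ^ d := by positivity
  have hD : 1 ≤ σ / 8 * 2 ^ d := by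
    have : (2 : ℝ) ^ (8 * w + 3) ≤ 2 ^ d := pow_le_pow_right₀ (by norm_num) hd
    rw [pow_add, ← hs] at this
    nlinarith
  obtain ⟨hc, hc'⟩ := choose_mul_le hn hσ hbig
  -- the density of the region is `m / 2 ^ d`
  obtain ⟨m, hm⟩ : ∃ m : ℕ, m = ⌈2 ^ d * (2 * ε₂ + σ / 5) / (1 - σ)⌉₊ := ⟨_, rfl⟩
  have h1σ : 0 < 1 - σ := by linarith
  have hm1 : 2 ^ d * (2 * ε₂ + σ / 5) ≤ m * (1 - σ) := by
    rw [← div_le_iff₀ h1σ, hm]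
    exact Nat.le_ceil _
  have hm2 : (m : ℝ) * (1 - σ) ≤ 2 ^ d * (2 * ε₂ + σ / 5) + 1 := by
    have h0 : 0 ≤ 2 ^ d * (2 * ε₂ + σ / 5) / (1 - σ) :=
      div_nonneg (mul_nonneg hD0.le (by linarith)) h1σ.le
    have := (Nat.ceil_lt_add_one h0).le
    rw [← hm, ← sub_le_iff_le_add, le_div_iff₀ h1σ] at this
    linarith
  have hm3 : m ≤ 2 ^ d := by
    rw [hm, Nat.ceil_le, div_le_iff₀ h1σ]
    push_cast
    exact mul_le_mul_of_nonneg_left (by linarith) hD0.le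
  have hm4 : 2 ^ d * 0.02 ≤ (m : ℝ) := by
    have : (m : ℝ) * (1 - σ) ≤ m := mul_le_of_le_one_right (by positivity) (by linarith)
    nlinarith
  obtain ⟨Z, -, hZ⟩ := Finset.exists_subset_card_eq
    (show m ≤ (Finset.univ : Finset (Fin d → Bool)).card by simpa using hm3)
  have hnd : n = d + 16 * w * a := by
    have := Fintype.card_congr e
    simpa [mul_assoc] using this
  have hW0 : (0 : ℝ) < 2 ^ (16 * w * a) := by positivity
  have hV2 : (2 : ℝ) ^ n = 2 ^ d * 2 ^ (16 * w * a) := by rw [hnd, pow_add]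
  have hR : ((region e Z).card : ℝ) = m * 2 ^ (16 * w * a) := by
    rw [card_region, hZ]; push_cast; ring
  refine (pow_le_of_isTolerantJuntaTester e ha (by norm_num) (region e Z) hA hq (fun t => ?_) ?_).trans_eq (by norm_num)
  · have hcard : ((hidden e t)ᶜ).card + 16 * w = n := by
      rw [Finset.card_compl, card_hidden, Fintype.card_fin]; omega
    refine (card_not_isCloseToJunta_le hcard (by omega) (mem_region_of_restrict_eq e t Z)
      (restrict_collapse e t) (card_fiber_collapse e t) (σ := s / 256) (β := 144 * σ)
      (τ := σ / 5 * 2 ^ n) (by positivity) ?_ (by linarith) (by positivity) ?_).trans ?_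
    · rw [hss]; push_cast; ring
    · rw [hR, hV2]
      have h3 : m * (1 - 144 * σ) + σ / 5 * 2 ^ d ≤ 2 * (ε₁ * 2 ^ d) := by
        have h4 := mul_le_mul_of_nonneg_right hm4 hσ0.le
        have h5 := mul_le_mul_of_nonneg_right hgap' hD0.le
        linarith
      have := mul_le_mul_of_nonneg_right h3 hW0.le
      linarith
    · exact mul_le_mul_of_nonneg_left hc' hK.le
  · refine (card_not_isFarFromJuntas_le hn (region e Z) hσ0 (by linarith) hσ
      (τ := σ / 5 * 2 ^ n) (by positivity) ?_).trans ?_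
    · rw [hR, hV2]
      have := mul_le_mul_of_nonneg_right hm1 hW0.le
      linarith
    · rw [mul_left_comm]
      exact mul_le_mul_of_nonneg_left hc hK.le

end LowerBound

/-! ### One query is not enough -/

/-- The parity function has distance `1/2` from all juntas on fewer variables. -/
lemma exists_far (k : ℕ) : ∃ f : BoolFun (k + 1), ∀ g : BoolFun (k + 1), IsJunta k g →
    2 * (hammingDist f g : ℝ) = 2 ^ (k + 1) := by
  let f : BoolFun (k + 1) := fun x => decide (Odd (Finset.univ.filter fun i => x i = true).card)
  have hflip : ∀ (x : Fin (k + 1) → Bool) i, f (flipAt i x) = !f x := fun x i => by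
    have h : ∀ y : Fin (k + 1) → Bool, (Finset.univ.filter fun j => y j = true).card =
        (if y i = true then 1 else 0) +
          ((Finset.univ.erase i).filter fun j => y j = true).card := fun y => by
      simp only [Finset.card_filter]
      rw [Finset.add_sum_erase _ (fun j => if y j = true then 1 else 0) (Finset.mem_univ i)]
    have h' : ((Finset.univ.erase i).filter fun j => flipAt i x j = true) =
        (Finset.univ.erase i).filter fun j => x j = true :=
      Finset.filter_congr fun j hj => by rw [flipAt_ne (Finset.ne_of_mem_erase hj)]
    simp only [f]
    rw [h, h x, h', flipAt_self]
    cases x i <;> simp [Nat.odd_add, parity_simps] <;> rw [Bool.eq_iff_iff] <;> simp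
  refine ⟨f, ?_⟩
  rintro g ⟨S, hS, hg⟩
  obtain ⟨i, hi⟩ : ∃ i, i ∉ S := by
    by_contra! h
    have := Finset.card_le_card (fun i _ => h i : Finset.univ ⊆ S)
    simp at this
    omega
  rw [two_mul_hammingDist]
  have h := Equiv.sum_comp (flipAt i) fun x => sgn (f x) * sgn (g x)
  have hg' : ∀ x, g (flipAt i x) = g x := fun x =>
    hg fun j hj => flipAt_ne (ne_of_mem_of_not_mem hj hi) x
  simp only [hflip, hg', sgn_not, neg_mul, Finset.sum_neg_distrib] at h
  linarith

lemma two_le_of_isTolerantJuntaTester {k : ℕ} {ε₁ ε₂ : ℝ} (h1 : 0 ≤ ε₁) (h2 : ε₂ ≤ 1 / 2)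
    {A : RandomizedAlg (k + 1)} (hA : IsTolerantJuntaTester k ε₁ ε₂ A) {q : ℕ}
    (hq : RandomizedAlg.MakesAtMost A q) : 2 ≤ q := by
  by_contra! hq2
  obtain ⟨f, hf⟩ := exists_far k
  have hnot : ∀ g : BoolFun (k + 1), IsJunta k g → IsJunta k fun x => !g x := fun g ⟨S, hS, hg⟩ =>
    ⟨S, hS, fun x y hxy => congrArg (! ·) (hg hxy)⟩
  have hfar : ∀ f : BoolFun (k + 1), (∀ g : BoolFun (k + 1), IsJunta k g →
      2 * (hammingDist f g : ℝ) = 2 ^ (k + 1)) → IsFarFromJuntas k ε₂ f := fun f hf g hg => by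
    have : (0 : ℝ) < 2 ^ (k + 1) := by positivity
    nlinarith [hf g hg]
  have hf' : ∀ g : BoolFun (k + 1), IsJunta k g →
      2 * (hammingDist (fun x => !f x) g : ℝ) = 2 ^ (k + 1) := fun g hg => by
    rw [← hf _ (hnot g hg)]
    have : hammingDist (fun x => !f x) g = hammingDist f fun x => !g x :=
      congrArg Finset.card (Finset.filter_congr fun x _ => by
        change (!f x) ≠ g x ↔ f x ≠ !g x
        cases f x <;> cases g x <;> simp)
    rw [this]
  have hclose : ∀ c : Bool, IsCloseToJunta k ε₁ (fun _ : Fin (k + 1) → Bool => c) := fun c =>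
    ⟨fun _ => c, ⟨∅, by simp, fun _ _ _ => rfl⟩, by rw [hammingDist_self]; simp; positivity⟩
  have hsum : RandomizedAlg.verdictOn A f false + RandomizedAlg.verdictOn A (fun x => !f x) false =
      RandomizedAlg.verdictOn A (fun _ => true) false +
        RandomizedAlg.verdictOn A (fun _ => !true) false := by
    simp only [RandomizedAlg.verdictOn_eq_tsum]
    rw [← ENNReal.tsum_add, ← ENNReal.tsum_add]
    refine tsum_congr fun T => ?_
    rw [← mul_add, ← mul_add]
    by_cases hT : T ∈ A.support
    · rw [verdict_const_of_queryCount_le_one (fun f => (hq T hT f).trans (by omega)) f fun _ => true]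
    · have : A T = 0 := by simpa [PMF.mem_support_iff] using hT
      simp [this]
  have hne : ∀ f b, RandomizedAlg.verdictOn A f b ≠ ⊤ := fun f b => PMF.apply_ne_top _ _
  have h23 : (2 / 3 : ENNReal).toReal = 2 / 3 := by simp
  have hadd : ∀ f, (RandomizedAlg.verdictOn A f true).toReal +
      (RandomizedAlg.verdictOn A f false).toReal = 1 := fun f => by
    rw [← ENNReal.toReal_add (hne _ _) (hne _ _), RandomizedAlg.verdictOn_add, ENNReal.toReal_one]
  have e1 := ENNReal.toReal_mono (hne _ _) (hA.rejects _ (hfar _ hf))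
  have e2 := ENNReal.toReal_mono (hne _ _) (hA.rejects _ (hfar _ hf'))
  have e3 := ENNReal.toReal_mono (hne _ _) (hA.accepts _ (hclose true))
  have e4 := ENNReal.toReal_mono (hne _ _) (hA.accepts _ (hclose !true))
  have e5 := congrArg ENNReal.toReal hsum
  rw [ENNReal.toReal_add (hne _ _) (hne _ _), ENNReal.toReal_add (hne _ _) (hne _ _)] at e5
  rw [h23] at e1 e2 e3 e4
  linarith [hadd fun _ => true, hadd fun _ => !true]

/-! ### Choice of the parameters -/

open Filter in
lemma eventually_add_mul_rpow_le (A B : ℝ) {c α β : ℝ} (hc : 0 < c) (hα : 0 ≤ α) (hαβ : α < β) :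
    ∀ᶠ k : ℕ in atTop, A + B * (k : ℝ) ^ α ≤ c * (k : ℝ) ^ β := by
  have h1 := ((tendsto_rpow_atTop (sub_pos.2 hαβ)).comp
    tendsto_natCast_atTop_atTop).eventually_ge_atTop ((|A| + |B|) / c)
  filter_upwards [h1, eventually_ge_atTop 1] with k hk hk1
  have hk1' : (1 : ℝ) ≤ k := by exact_mod_cast hk1
  have hx : 1 ≤ (k : ℝ) ^ α := Real.one_le_rpow hk1' hα
  rw [Function.comp_apply, div_le_iff₀ hc] at hk
  calc A + B * (k : ℝ) ^ α ≤ |A| * (k : ℝ) ^ α + |B| * (k : ℝ) ^ α := by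
        gcongr
        · exact (le_abs_self A).trans (le_mul_of_one_le_right (abs_nonneg A) hx)
        · exact le_abs_self B
    _ = (|A| + |B|) * (k : ℝ) ^ α := by ring
    _ ≤ (k : ℝ) ^ (β - α) * c * (k : ℝ) ^ α := by gcongr
    _ = c * (k : ℝ) ^ β := by
        rw [mul_right_comm, ← Real.rpow_add (by linarith), sub_add_cancel, mul_comm]

open Filter in
/-- If the blocks have at most `O(k ^ 0.99)` elements each, the hidden set is small compared with
`k`, and there remain many choices for each of its elements. -/
lemma exists_forall_width_le (D : ℝ) (hD : 0 < D) :
    ∃ k₀ : ℕ, 0 < k₀ ∧ ∀ k w : ℕ, k₀ ≤ k → 0 < w → (w : ℝ) ≤ D * (k : ℝ) ^ (0.99 : ℝ) →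
      32 * w ≤ k ∧ 2 ^ 41 * (2 * (k + 16 * w)) ^ (16 * w) ≤ 2 ^ (k + 16 * w) ∧
      64 * (k : ℝ) ^ (0.005 : ℝ) ≤ (k / (32 * w) : ℕ) := by
  have h1 := eventually_add_mul_rpow_le 0 (32 * D) (c := 1) (α := 0.99) (β := 1)
    one_pos (by norm_num) (by norm_num)
  have h2 := eventually_add_mul_rpow_le (41 * Real.log 2) (16 * D * (4 ^ (0.005 : ℝ) / 0.005))
    (c := Real.log 2) (α := 0.995) (β := 1) (Real.log_pos one_lt_two) (by norm_num) (by norm_num)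
  have h3 := eventually_add_mul_rpow_le 1 64 (c := 1 / (32 * D)) (α := 0.005) (β := 0.01)
    (by positivity) (by norm_num) (by norm_num)
  obtain ⟨k₀, hk₀⟩ := eventually_atTop.1 ((h1.and h2).and h3)
  refine ⟨max 1 k₀, by positivity, fun k w hk hw hwk => ?_⟩
  obtain ⟨⟨h1, h2⟩, h3⟩ := hk₀ k ((le_max_right _ _).trans hk)
  have hk1 : 1 ≤ k := (le_max_left _ _).trans hk
  have hk0 : (0 : ℝ) < k := by exact_mod_cast hk1
  have hw0 : (0 : ℝ) < w := by exact_mod_cast hw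
  rw [Real.rpow_one] at h1 h2
  have h32 : 32 * w ≤ k := by
    have : (32 : ℝ) * w ≤ k := by linarith
    exact_mod_cast this
  refine ⟨h32, ?_, ?_⟩
  · have hlog : Real.log (4 * k) ≤ 4 ^ (0.005 : ℝ) / 0.005 * (k : ℝ) ^ (0.005 : ℝ) := by
      refine (Real.log_le_rpow_div (x := 4 * k) (by positivity)
        (show (0 : ℝ) < 0.005 by norm_num)).trans (le_of_eq ?_)
      rw [Real.mul_rpow (by norm_num) hk0.le]
      ring
    have hexp : (k : ℝ) ^ (0.995 : ℝ) = (k : ℝ) ^ (0.99 : ℝ) * (k : ℝ) ^ (0.005 : ℝ) := by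
      rw [← Real.rpow_add hk0]; norm_num
    have h4k : 0 ≤ Real.log (4 * k) := Real.log_nonneg (by
      have : (1 : ℝ) ≤ k := by exact_mod_cast hk1
      linarith)
    have hmul : (w : ℝ) * Real.log (4 * k) ≤
        D * (k : ℝ) ^ (0.99 : ℝ) * (4 ^ (0.005 : ℝ) / 0.005 * (k : ℝ) ^ (0.005 : ℝ)) :=
      mul_le_mul hwk hlog h4k (by positivity)
    have hreal : (2 : ℝ) ^ 41 * (4 * k) ^ (16 * w) ≤ 2 ^ k := by
      rw [← Real.log_le_log_iff (by positivity) (by positivity),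
        Real.log_mul (by positivity) (by positivity), Real.log_pow, Real.log_pow, Real.log_pow]
      rw [hexp] at h2
      push_cast
      linarith
    have hnat : 2 ^ 41 * (4 * k) ^ (16 * w) ≤ 2 ^ k := by exact_mod_cast hreal
    calc 2 ^ 41 * (2 * (k + 16 * w)) ^ (16 * w) ≤ 2 ^ 41 * (4 * k) ^ (16 * w) :=
          Nat.mul_le_mul_left _ (Nat.pow_le_pow_left (by omega) _)
      _ ≤ 2 ^ k := hnat
      _ ≤ 2 ^ (k + 16 * w) := Nat.pow_le_pow_right (by norm_num) (by omega)
  · have hdiv : (k : ℝ) / (32 * w) - 1 ≤ (k / (32 * w) : ℕ) := by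
      have := Nat.lt_floor_add_one ((k : ℝ) / (32 * w : ℕ))
      rw [Nat.floor_div_natCast, Nat.floor_natCast] at this
      push_cast at this ⊢
      linarith
    have h4 : 1 / (32 * D) * (k : ℝ) ^ (0.01 : ℝ) ≤ k / (32 * w) := by
      rw [le_div_iff₀ (by positivity)]
      have hexp : (k : ℝ) = (k : ℝ) ^ (0.01 : ℝ) * (k : ℝ) ^ (0.99 : ℝ) := by
        rw [← Real.rpow_add hk0]; norm_num
      calc 1 / (32 * D) * (k : ℝ) ^ (0.01 : ℝ) * (32 * w)
          ≤ 1 / (32 * D) * (k : ℝ) ^ (0.01 : ℝ) * (32 * (D * (k : ℝ) ^ (0.99 : ℝ))) := by gcongr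
        _ = (k : ℝ) ^ (0.01 : ℝ) * (k : ℝ) ^ (0.99 : ℝ) := by field_simp
        _ = k := hexp.symm
    linarith

/-- The lower bound in terms of the size `w` of the blocks. -/
lemma div_pow_le_of_isTolerantJuntaTester {k w : ℕ} (hw : 0 < w) (hk : 32 * w ≤ k)
    (hbig : 2 ^ 41 * (2 * (k + 16 * w)) ^ (16 * w) ≤ 2 ^ (k + 16 * w)) {ε₁ ε₂ : ℝ}
    (h1 : 0.01 ≤ ε₁) (h12 : ε₁ < ε₂) (h2 : ε₂ ≤ 0.49)
    (hgap : w = 1 ∨ (ε₂ - ε₁) * 2 ^ (8 * w) ≤ 1)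
    {A : RandomizedAlg (k + 16 * w)} (hA : IsTolerantJuntaTester k ε₁ ε₂ A) {q : ℕ}
    (hq : RandomizedAlg.MakesAtMost A q) :
    ((k / (32 * w) : ℕ) : ℝ) ^ w ≤ 64 * (q : ℝ) ^ 2 := by
  have : NeZero w := ⟨hw.ne'⟩
  set a := k / (32 * w) with ha
  have ha0 : 0 < a := Nat.div_pos hk (by positivity)
  have hak : 16 * (w * a) + 16 * (w * a) ≤ k := by
    have := Nat.div_mul_le_self k (32 * w)
    rw [← ha] at this
    linarith
  let e : Fin (k + 16 * w) ≃ Fin (k + 16 * w - 16 * (w * a)) ⊕ (Fin 16 × Fin w × Fin a) :=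
    Fintype.equivOfCardEq (by simp; omega)
  rcases (show w = 1 ∨ 2 ≤ w by omega) with rfl | hw2
  · exact pow_le_of_width_one e ha0 rfl hbig h1 h2 hA hq
  · exact pow_le_of_gap_le e ha0 hw2 (by omega) rfl hbig h1 h12 h2
      (hgap.resolve_left (by omega)) hA hq

end JuntaTesting

open JuntaTesting in
/-- For every constant `C` in `2^{-O(k^0.99)}` there is a constant `c > 0` in the exponent of the
lower bound. A tester has to handle functions of any number of variables; the number `n` of
variables for which the bound is reached is the same for all testers. -/
theorem theorem1 :
    ∀ C : ℝ, 0 < C → ∃ c : ℝ, 0 < c ∧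
      ∀ (k : ℕ) (ε₁ ε₂ : ℝ), 0.01 ≤ ε₁ → ε₁ < ε₂ → ε₂ ≤ 0.49 →
        (2 : ℝ) ^ (-(C * (k : ℝ) ^ (0.99 : ℝ))) ≤ ε₂ - ε₁ →
        ∃ n : ℕ, ∀ A : RandomizedAlg n, IsTolerantJuntaTester k ε₁ ε₂ A →
          ∀ q : ℕ, RandomizedAlg.MakesAtMost A q →
            (k : ℝ) ^ (-(c * Real.logb 2 (ε₂ - ε₁))) ≤ (q : ℝ) := by
  intro C hC
  obtain ⟨k₀, hk₀, hlarge⟩ := exists_forall_width_le (1 + C) (by positivity)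
  have hk₀' : (0 : ℝ) < k₀ := by exact_mod_cast hk₀
  -- The second term makes the bound at most `2` for `k ≤ k₀`.
  refine ⟨min (0.005 / 32) (1 / (k₀ * (C * (k₀ : ℝ) ^ (0.99 : ℝ)))), by positivity, ?_⟩
  set c := min (0.005 / 32 : ℝ) (1 / (k₀ * (C * (k₀ : ℝ) ^ (0.99 : ℝ)))) with hc
  have hc0 : 0 < c := by positivity
  intro k ε₁ ε₂ h1 h12 h2 hgap
  have hε : 0 < ε₂ - ε₁ := by linarith
  obtain ⟨L, hL⟩ : ∃ L : ℝ, L = -Real.logb 2 (ε₂ - ε₁) := ⟨_, rfl⟩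
  have hεL : ε₂ - ε₁ = (2 : ℝ) ^ (-L) := by
    rw [hL, neg_neg, Real.rpow_logb (by norm_num) (by norm_num) hε]
  have hL0 : 0 ≤ L := by
    have := Real.logb_nonpos one_lt_two hε.le (show ε₂ - ε₁ ≤ 1 by linarith)
    linarith
  have hLC : L ≤ C * (k : ℝ) ^ (0.99 : ℝ) := by
    rw [hεL, Real.rpow_le_rpow_left_iff one_lt_two] at hgap
    linarith
  have hexp : -(c * Real.logb 2 (ε₂ - ε₁)) = c * L := by rw [hL]; ring
  rw [hexp]
  by_cases hk : k₀ ≤ k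
  · have hk1 : (1 : ℝ) ≤ k := by exact_mod_cast hk₀.trans_le hk
    have hk99 : 1 ≤ (k : ℝ) ^ (0.99 : ℝ) := Real.one_le_rpow hk1 (by norm_num)
    obtain ⟨w, hwdef⟩ : ∃ w : ℕ, w = max 1 ⌊L / 8⌋₊ := ⟨_, rfl⟩
    have hw : 0 < w := by omega
    have hw1 : (1 : ℝ) ≤ w := by exact_mod_cast hw
    have hfl : (⌊L / 8⌋₊ : ℝ) ≤ L / 8 := Nat.floor_le (by positivity)
    have hwD : (w : ℝ) ≤ (1 + C) * (k : ℝ) ^ (0.99 : ℝ) := by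
      rw [hwdef, Nat.cast_max, Nat.cast_one]
      refine max_le ?_ ?_ <;> nlinarith
    have hwL : L ≤ 16 * w := by
      have : (⌊L / 8⌋₊ : ℝ) ≤ w := by rw [hwdef]; exact_mod_cast le_max_right _ _
      have := Nat.lt_floor_add_one (L / 8)
      linarith
    have hwgap : w = 1 ∨ (ε₂ - ε₁) * 2 ^ (8 * w) ≤ 1 := by
      rcases le_total ⌊L / 8⌋₊ 1 with h | h
      · left; omega
      · right
        have hw8 : (w : ℝ) ≤ L / 8 := by
          rw [hwdef, max_eq_right h]; exact hfl
        rw [hεL, ← Real.rpow_natCast, ← Real.rpow_add two_pos]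
        refine Real.rpow_le_one_of_one_le_of_nonpos one_le_two ?_
        push_cast
        linarith
    obtain ⟨h32, hbig, ha⟩ := hlarge k w hk hw hwD
    refine ⟨k + 16 * w, fun A hA q hq => ?_⟩
    have hmain := div_pow_le_of_isTolerantJuntaTester hw h32 hbig h1 h12 h2 hwgap hA hq
    have h3 : (64 * (k : ℝ) ^ (0.005 : ℝ)) ^ w ≤ 64 * (q : ℝ) ^ 2 :=
      (pow_le_pow_left₀ (by positivity) ha w).trans hmain
    have h4 : ((k : ℝ) ^ (c * L)) ^ 2 ≤ ((k : ℝ) ^ (0.005 : ℝ)) ^ w := by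
      rw [← Real.rpow_natCast, ← Real.rpow_natCast, ← Real.rpow_mul (by positivity),
        ← Real.rpow_mul (by positivity)]
      refine Real.rpow_le_rpow_of_exponent_le hk1 ?_
      have h5 : c * L ≤ 0.005 / 32 * (16 * w) :=
        mul_le_mul (min_le_left _ _) hwL hL0 (by norm_num)
      push_cast
      linarith
    have h5 : (64 : ℝ) ≤ 64 ^ w := le_self_pow₀ (by norm_num) hw.ne'
    rw [mul_pow] at h3
    have h6 : 64 * ((k : ℝ) ^ (c * L)) ^ 2 ≤ 64 * (q : ℝ) ^ 2 :=
      (mul_le_mul h5 h4 (by positivity) (by positivity)).trans h3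
    exact le_of_sq_le_sq (by linarith) (by positivity)
  · push Not at hk
    refine ⟨k + 1, fun A hA q hq => ?_⟩
    have hq2 : (2 : ℝ) ≤ q := by
      exact_mod_cast two_le_of_isTolerantJuntaTester (by linarith) (by linarith) hA hq
    refine le_trans ?_ hq2
    have hkk : (k : ℝ) ≤ k₀ := by exact_mod_cast hk.le
    have hk2 : (k : ℝ) ≤ 2 ^ (k₀ : ℝ) := by
      rw [Real.rpow_natCast]
      exact hkk.trans (by exact_mod_cast Nat.lt_two_pow_self.le)
    have hLk : L ≤ C * (k₀ : ℝ) ^ (0.99 : ℝ) := hLC.trans (by gcongr)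
    calc (k : ℝ) ^ (c * L) ≤ (2 ^ (k₀ : ℝ)) ^ (c * L) :=
          Real.rpow_le_rpow (by positivity) hk2 (by positivity)
      _ = 2 ^ ((k₀ : ℝ) * (c * L)) := (Real.rpow_mul (by norm_num) _ _).symm
      _ ≤ 2 ^ (1 : ℝ) := by
          refine Real.rpow_le_rpow_of_exponent_le one_le_two ?_
          calc (k₀ : ℝ) * (c * L)
              ≤ k₀ * (1 / (k₀ * (C * (k₀ : ℝ) ^ (0.99 : ℝ))) * (C * (k₀ : ℝ) ^ (0.99 : ℝ))) := by
                gcongr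
                exact min_le_right _ _
            _ = 1 := by field_simp
      _ = 2 := Real.rpow_one 2
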